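/- Let $n\ge 0$ and $[n]=\{1,\dots,n\}$. Identify a directed graph on $[n]$ (loops allowed) with its set of edges $\Gamma\subset[n]\times[n]$. Let $\Delta_n$ be the chessboard complex: the simplicial complex of all $\Gamma$ in which any two distinct edges have different tails and different heads. Let $\Delta_n^{DM}\subset\Delta_n$ be the complex of directed matchings: the loopless $\Gamma$ in which every vertex has in-degree and out-degree at most one. Let $\Omega_n\subset\Delta_n$ be the cycle-free chessboard complex: the complex of all subsets of the configurations $\{(i_1,i_2),(i_2,i_3),\dots,(i_{n-1},i_n)\}$, where $i_1\prec i_2\prec\dots\prec i_n$ runs over all linear orders on $[n]$. For $p\ge 0$ let $F_p^{I}=F_p(\Delta_n)$ (respectively $F_p^{II}=F_p(\Delta_n^{DM})$) be the subcomplex of all $\Gamma\in\Delta_n$ (respectively $\Gamma\in\Delta_n^{DM}$) such that at most $p$ of the connected components of $\Gamma$ are directed cycles (a loop is a cycle of length $1$). A $p$-multicycle is a directed graph $C=C_1\uplus\dots\uplus C_p$ on $[n]$ with exactly $p$ connected components (isolated vertices not counted), each $C_j$ being a directed cycle of some length $l_j\ge1$; its length is $l(C)=l_1+\dots+l_p$.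 Let $\mathcal C_p$ be the set of all $p$-multicycles and $\mathcal C_p^{\ge2}$ the set of those with $l_j\ge2$ for all $j$. Then $$F_0^{I}=F_0^{II}=\Omega_n,$$ and for every $p\ge1$, passing to geometric realizations, $$F_p^{I}/F_{p-1}^{I}\;\simeq\;\bigvee_{C\in\mathcal C_p}S^{l(C)-1}*\Omega_{n-l(C)}\;\cong\;\bigvee_{C\in\mathcal C_p}\Sigma^{l(C)}(\Omega_{n-l(C)}),$$ $$F_p^{II}/F_{p-1}^{II}\;\simeq\;\bigvee_{C\in\mathcal C_p^{\ge2}}S^{l(C)-1}*\Omega_{n-l(C)}\;\cong\;\bigvee_{C\in\mathcal C_p^{\ge2}}\Sigma^{l(C)}(\Omega_{n-l(C)}).$$ Here $\simeq$ is homotopy equivalence, $\cong$ is homeomorphism, $*$ is the join, $\Sigma^{l}$ is the $l$-fold unreduced suspension (so $X*\emptyset=X$ and $\Sigma\emptyset=S^0$). The base points of the wedge summands are a point of the sphere $S^{l(C)-1}$ in each join, and a pole of the last suspension in each $\Sigma^{l(C)}(\Omega_{n-l(C)})$. Moreover $X/\emptyset$ is $X$ with a disjoint point added, and the wedge of an empty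 family is a point. -/

import Mathlib

open scoped ContinuousMap unitInterval

noncomputable section

/-! ## Directed graphs on the vertex set `Fin n`

A directed graph on `Fin n` (loops allowed) is identified with its finite set of edges
`(tail, head)`, that is, with a set of squares of the `n × n` chessboard. -/

/-- Directed graphs with vertex set `Fin n`, as sets of edges. -/
abbrev DiGraph (n : ℕ) : Type := Finset (Fin n × Fin n)

namespace DiGraph

variable {n : ℕ}

/-- `a` and `b` lie in the same (weakly) connected component of `G`. -/
def Conn (G : DiGraph n) : Fin n → Fin n → Prop :=
  Relation.EqvGen fun a b => (a, b) ∈ G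

open Classical in
/-- The edges of the connected component of `G` that contains the vertex `v`. -/
def component (G : DiGraph n) (v : Fin n) : DiGraph n :=
  G.filter fun e => G.Conn v e.1

/-- The connected components of `G` that have at least one edge, each given by its edges.
The components without edges are isolated vertices. -/
def components (G : DiGraph n) : Finset (DiGraph n) :=
  G.image fun e => G.component e.1

/-- `C = {(x₀,x₁), (x₁,x₂), …, (x_k,x₀)}` for pairwise distinct vertices `x₀, …, x_k`.
The length `k + 1` of the cycle is its number of edges; `k = 0` is a loop. -/
def IsCycle (C : DiGraph n) : Prop :=
  ∃ (k : ℕ) (x : Fin (k + 1) → Fin n), Function.Injective x ∧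
    C = Finset.univ.image fun i => (x i, x (i + 1))

open Classical in
/-- The number of cycles among the connected components of `G`. -/
def numCycles (G : DiGraph n) : ℕ :=
  (G.components.filter IsCycle).card

/-- `C` is a `p`-multicycle: it has exactly `p` connected components, and each is a cycle. -/
def IsMulticycle (p : ℕ) (C : DiGraph n) : Prop :=
  C.components.card = p ∧ ∀ D ∈ C.components, IsCycle D

/-- The type of a multicycle: the multiset of the lengths of its cycles. -/
def cycleType (C : DiGraph n) : Multiset ℕ :=
  C.components.val.map Finset.card

/-- The length of a multicycle: the sum of the lengths of its cycles. -/
def length (C : DiGraph n) : ℕ :=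
  C.cycleType.sum

/-- A `p`-multicycle with `p ≥ 1` has positive length. -/
theorem length_pos {p : ℕ} {C : DiGraph n} (hC : IsMulticycle p C) (hp : 1 ≤ p) :
    0 < C.length := by
  obtain ⟨D, hD⟩ : C.components.Nonempty := by
    rw [← Finset.card_pos, hC.1]; exact hp
  obtain ⟨k, x, -, hx⟩ := hC.2 D hD
  have h1 : 0 < D.card := by
    rw [Finset.card_pos, hx]
    exact ⟨_, Finset.mem_image_of_mem _ (Finset.mem_univ 0)⟩
  have h2 : D.card ≤ C.length :=
    Multiset.le_sum_of_mem (Multiset.mem_map_of_mem _ hD)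
  omega

end DiGraph

/-! ## The complexes

The empty configuration is not listed among the faces, following Mathlib's convention. -/

/-- Non-taking rook configurations: distinct rooks are in distinct columns and distinct rows. -/
def IsRookConfig {n : ℕ} (S : DiGraph n) : Prop :=
  ∀ e ∈ S, ∀ f ∈ S, e ≠ f → e.1 ≠ f.1 ∧ e.2 ≠ f.2

/-- The chessboard complex `Δ_n`. -/
def chessboardComplex (n : ℕ) : PreAbstractSimplicialComplex (Fin n × Fin n) where
  faces := {S | S.Nonempty ∧ IsRookConfig S}
  isRelLowerSet_faces := fun _ hS =>
    ⟨hS.1, fun _ hTS hT => ⟨hT, fun e he f hf => hS.2 e (hTS he) f (hTS hf)⟩⟩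

/-- The complex `Δ_n^{DM}` of directed matchings: loopless directed graphs on `Fin n` in which
every vertex has out-degree and in-degree at most one. -/
def directedMatchingComplex (n : ℕ) : PreAbstractSimplicialComplex (Fin n × Fin n) where
  faces := {G | G.Nonempty ∧ (∀ e ∈ G, e.1 ≠ e.2) ∧
    ∀ v : Fin n, (G.filter fun e => e.1 = v).card ≤ 1 ∧ (G.filter fun e => e.2 = v).card ≤ 1}
  isRelLowerSet_faces := fun _ hS =>
    ⟨hS.1, fun _ hTS hT => ⟨hT, fun e he => hS.2.1 e (hTS he), fun v =>
      ⟨(Finset.card_le_card (Finset.filter_subset_filter _ hTS)).trans (hS.2.2 v).1,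
        (Finset.card_le_card (Finset.filter_subset_filter _ hTS)).trans (hS.2.2 v).2⟩⟩⟩

/-- The configuration `S_ρ = {(i₁,i₂), (i₂,i₃), …, (i_{n-1},i_n)}` of the linear order
`ρ : i₁ ≺ i₂ ≺ … ≺ i_n` on `Fin n`; the order is given by the bijection `k ↦ i_k`. -/
def linearOrderConfig {n : ℕ} (ρ : Fin n ≃ Fin n) : DiGraph n :=
  Finset.univ.filter fun e => (ρ.symm e.1 : ℕ) + 1 = ρ.symm e.2

/-- The cycle-free chessboard complex `Ω_n`: the closure under passing to subsets of the
configurations `S_ρ`, where `ρ` runs over all linear orders on `Fin n`. -/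
def cycleFreeComplex (n : ℕ) : PreAbstractSimplicialComplex (Fin n × Fin n) where
  faces := {S | S.Nonempty ∧ ∃ ρ : Fin n ≃ Fin n, S ⊆ linearOrderConfig ρ}
  isRelLowerSet_faces := fun _ hS =>
    ⟨hS.1, fun _ hTS hT => ⟨hT, hS.2.imp fun _ h => hTS.trans h⟩⟩

/-- `Δ_n^{DM}` is a subcomplex of `Δ_n`. -/
theorem directedMatchingComplex_le (n : ℕ) :
    directedMatchingComplex n ≤ chessboardComplex n := by
  rintro S ⟨hne, -, h⟩
  refine ⟨hne, fun e he f hf hef => ⟨fun h1 => hef ?_, fun h2 => hef ?_⟩⟩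
  · exact Finset.card_le_one.1 (h f.1).1 e (Finset.mem_filter.2 ⟨he, h1⟩) f
      (Finset.mem_filter.2 ⟨hf, rfl⟩)
  · exact Finset.card_le_one.1 (h f.2).2 e (Finset.mem_filter.2 ⟨he, h2⟩) f
      (Finset.mem_filter.2 ⟨hf, rfl⟩)

/-- Deleting edges does not increase the number of cycles of a rook configuration. -/
theorem numCycles_mono {n : ℕ} {S T : DiGraph n} (hT : IsRookConfig T) (hST : S ⊆ T) :
    S.numCycles ≤ T.numCycles := by
  classical
  refine Finset.card_le_card fun D hD => ?_
  obtain ⟨hDS, hDc⟩ := Finset.mem_filter.1 hD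
  refine Finset.mem_filter.2 ⟨?_, hDc⟩
  obtain ⟨k, x, hx, rfl⟩ := hDc
  obtain ⟨e, he, hcomp⟩ := Finset.mem_image.1 hDS
  have hsub : ∀ i, (x i, x (i + 1)) ∈ T := fun i => by
    have : (x i, x (i + 1)) ∈ S.component e.1 := by
      rw [hcomp]; exact Finset.mem_image_of_mem _ (Finset.mem_univ i)
    exact hST (Finset.mem_filter.1 this).1
  have hout : ∀ f ∈ T, ∀ i, f.1 = x i → f = (x i, x (i + 1)) := fun f hf i hfi => by
    by_contra hne
    exact (hT f hf _ (hsub i) hne).1 hfi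
  have hin : ∀ f ∈ T, ∀ i, f.2 = x (i + 1) → f = (x i, x (i + 1)) := fun f hf i hfi => by
    by_contra hne
    exact (hT f hf _ (hsub i) hne).2 hfi
  have hconn : ∀ a b, T.Conn a b → (a ∈ Set.range x ↔ b ∈ Set.range x) := by
    intro a b h
    induction h with
    | rel a b h =>
      constructor
      · rintro ⟨i, rfl⟩
        have := hout _ h i rfl
        exact ⟨i + 1, (congrArg Prod.snd this).symm⟩
      · rintro ⟨i, rfl⟩
        have := hin _ h (i - 1) (by simp)
        exact ⟨i - 1, (congrArg Prod.fst this).symm⟩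
    | refl => rfl
    | symm _ _ _ ih => exact ih.symm
    | trans _ _ _ _ _ ih1 ih2 => exact ih1.trans ih2
  have hemem : e ∈ S.component e.1 := Finset.mem_filter.2 ⟨he, Relation.EqvGen.refl _⟩
  have hex : e.1 ∈ Set.range x := by
    rw [hcomp] at hemem
    obtain ⟨i, -, hi⟩ := Finset.mem_image.1 hemem
    exact ⟨i, congrArg Prod.fst hi⟩
  refine Finset.mem_image.2 ⟨e, hST he, ?_⟩
  ext f
  constructor
  · intro hf
    obtain ⟨hfT, hfc⟩ := Finset.mem_filter.1 hf
    obtain ⟨i, hi⟩ := (hconn _ _ hfc).1 hex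
    exact Finset.mem_image.2 ⟨i, Finset.mem_univ i, (hout f hfT i hi.symm).symm⟩
  · intro hf
    rw [← hcomp] at hf
    obtain ⟨hfS, hfc⟩ := Finset.mem_filter.1 hf
    exact Finset.mem_filter.2 ⟨hST hfS, Relation.EqvGen.mono (fun _ _ h => hST h) _ _ hfc⟩

/-- For a subcomplex `K` of `Δ_n`, the subcomplex `F_p(K)` of all the graphs in `K` with at most
`p` cycles among their connected components. -/
def cycleFiltration {n : ℕ} (K : PreAbstractSimplicialComplex (Fin n × Fin n))
    (hK : K ≤ chessboardComplex n) (p : ℕ) : PreAbstractSimplicialComplex (Fin n × Fin n) where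
  faces := {G | G ∈ K.faces ∧ DiGraph.numCycles G ≤ p}
  isRelLowerSet_faces := fun _ hS =>
    ⟨(K.isRelLowerSet_faces hS.1).1, fun _ hTS hT =>
      ⟨(K.isRelLowerSet_faces hS.1).2 hTS hT, (numCycles_mono (hK hS.1).2 hTS).trans hS.2⟩⟩

/-- `F_p^I = F_p(Δ_n)`. -/
def filtrationI (n p : ℕ) : PreAbstractSimplicialComplex (Fin n × Fin n) :=
  cycleFiltration (chessboardComplex n) le_rfl p

/-- `F_p^{II} = F_p(Δ_n^{DM})`. -/
def filtrationII (n p : ℕ) : PreAbstractSimplicialComplex (Fin n × Fin n) :=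
  cycleFiltration (directedMatchingComplex n) (directedMatchingComplex_le n) p

/-! ## Topological constructions -/

/-- The geometric realization of a simplicial complex on a finite vertex set `V`: the union in
`ℝ^V` of the standard simplices spanned by its faces. -/
def realization {V : Type} [Fintype V] (K : PreAbstractSimplicialComplex V) : Set (V → ℝ) :=
  {x | x ∈ stdSimplex ℝ V ∧ ∃ s ∈ K.faces, ∀ v, v ∉ s → x v = 0}

/-- Identification of all points of `A` with the added point. -/
inductive Collapse.Rel {X : Type} (A : Set X) : Unit ⊕ X → Unit ⊕ X → Prop
  | mk (a : X) (ha : a ∈ A) : Collapse.Rel A (Sum.inr a) (Sum.inl ())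

/-- The quotient space `X / A`. As usual, `X / ∅` is `X` with a disjoint point added. -/
def Collapse {X : Type} (A : Set X) : Type := Quot (Collapse.Rel A)

instance {X : Type} [TopologicalSpace X] (A : Set X) : TopologicalSpace (Collapse A) :=
  inferInstanceAs (TopologicalSpace (Quot _))

/-- The quotient `|K| / |L|` of a complex `K` by a subcomplex `L`. -/
abbrev QuotientSpace {V : Type} [Fintype V] (K L : PreAbstractSimplicialComplex V) : Type :=
  Collapse {x : realization K | (x : V → ℝ) ∈ realization L}

/-- The wedge of the pointed spaces `(X i, x i)`: their disjoint union with all base points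
identified. The wedge of an empty family is a point. -/
abbrev Wedge {ι : Type} (X : ι → Type) (x : ∀ i, X i) : Type :=
  Collapse (Set.range fun i => (⟨i, x i⟩ : Σ i, X i))

/-- The identifications `(x, y, 0) ∼ x` and `(x, y, 1) ∼ y` that define the join. -/
inductive Join.Rel (X Y : Type) : (X × Y × I) ⊕ (X ⊕ Y) → (X × Y × I) ⊕ (X ⊕ Y) → Prop
  | left (x : X) (y : Y) : Join.Rel X Y (Sum.inl (x, y, 0)) (Sum.inr (Sum.inl x))
  | right (x : X) (y : Y) : Join.Rel X Y (Sum.inl (x, y, 1)) (Sum.inr (Sum.inr y))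

/-- The join `X ∗ Y`, with the quotient topology. -/
def Join (X Y : Type) : Type := Quot (Join.Rel X Y)

instance (X Y : Type) [TopologicalSpace X] [TopologicalSpace Y] : TopologicalSpace (Join X Y) :=
  inferInstanceAs (TopologicalSpace (Quot _))

/-- The inclusion of the first factor in the join. -/
def Join.inl {X Y : Type} (x : X) : Join X Y := Quot.mk _ (Sum.inr (Sum.inl x))

/-- The identifications `(x, 0) ∼ N` and `(x, 1) ∼ S` that define the suspension. -/
inductive Susp.Rel (X : Type) : (X × I) ⊕ Bool → (X × I) ⊕ Bool → Prop
  | north (x : X) : Susp.Rel X (Sum.inl (x, 0)) (Sum.inr true)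
  | south (x : X) : Susp.Rel X (Sum.inl (x, 1)) (Sum.inr false)

/-- The (unreduced) suspension `Σ X`, with the quotient topology. Here `Σ ∅ = S⁰`. -/
def Susp (X : Type) : Type := Quot (Susp.Rel X)

instance (X : Type) [TopologicalSpace X] : TopologicalSpace (Susp X) :=
  inferInstanceAs (TopologicalSpace (Quot _))

/-- The pole `N` of a suspension. -/
def Susp.pole (X : Type) : Susp X := Quot.mk _ (Sum.inr true)

/-- The iterated suspension `Σ^l X`. -/
def iterSusp : ℕ → TopCat.{0} → TopCat.{0}
  | 0, X => X
  | l + 1, X => TopCat.of (Susp (iterSusp l X))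

/-- For `l ≥ 1`, the pole `N` of the last suspension in `Σ^l X = Σ (Σ^{l-1} X)`. -/
def iterSuspPole : ∀ (l : ℕ) (_ : 0 < l) (X : TopCat.{0}), iterSusp l X
  | l + 1, _, X => Susp.pole (iterSusp l X)

/-- The unit sphere `S^{l-1}` of `ℝ^l`; in particular `S^{-1} = ∅`. -/
abbrev unitSphere (l : ℕ) : Type := Metric.sphere (0 : EuclideanSpace ℝ (Fin l)) 1

/-- For `l ≥ 1`, the first standard basis vector, as a point of `S^{l-1}`. -/
def spherePoint (l : ℕ) (h : 0 < l) : unitSphere l :=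
  ⟨EuclideanSpace.single ⟨0, h⟩ 1, by simp⟩

/-! ## The wedges indexed by multicycles -/

/-- The set `𝒞_p` of all `p`-multicycles on `Fin n`. -/
def multicycles (n p : ℕ) : Set (DiGraph n) := {C | DiGraph.IsMulticycle p C}

/-- The set `𝒞_p^{≥2}` of all `p`-multicycles whose cycles all have length at least `2`. -/
def multicyclesGeTwo (n p : ℕ) : Set (DiGraph n) :=
  {C | DiGraph.IsMulticycle p C ∧ ∀ l ∈ DiGraph.cycleType C, 2 ≤ l}

/-- The wedge of the joins `S^{l(C)-1} ∗ Ω_{n-l(C)}` over a set `𝒞` of multicycles of positive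
length; the base point of each join is a point of the sphere. -/
abbrev JoinWedge {n : ℕ} (𝒞 : Set (DiGraph n)) (h : ∀ C ∈ 𝒞, 0 < DiGraph.length C) : Type :=
  Wedge (fun C : 𝒞 => Join (unitSphere (DiGraph.length C.1))
      (realization (cycleFreeComplex (n - DiGraph.length C.1))))
    fun C => Join.inl (spherePoint _ (h C.1 C.2))

/-- The wedge of the iterated suspensions `Σ^{l(C)} Ω_{n-l(C)}` over a set `𝒞` of multicycles of
positive length; the base point of each suspension is a pole. -/
abbrev SuspWedge {n : ℕ} (𝒞 : Set (DiGraph n)) (h : ∀ C ∈ 𝒞, 0 < DiGraph.length C) : Type :=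
  Wedge (fun C : 𝒞 => iterSusp (DiGraph.length C.1)
      (TopCat.of (realization (cycleFreeComplex (n - DiGraph.length C.1)))))
    fun C => iterSuspPole _ (h C.1 C.2) _

end

/-!
The quotient `F_p / F_{p-1}` of either filtration is computed one multicycle at a time. A rook
configuration `S` with exactly `p` cycles contains a unique `p`-multicycle, the union of its cycles
(`DiGraph.isMulticycle_core`, `DiGraph.IsMulticycle.eq_core`), because a cycle contained in a rook
configuration is automatically a connected component (`DiGraph.IsCycle.component_eq`). The
remaining edges of `S` avoid the vertices of the multicycle `C` and form a cycle-free configuration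
on the other `n - l(C)` vertices. So the faces in `F_p` but not in `F_{p-1}` are sorted by `C`, and
the star of `C`, regarded as a simplex with `l(C)` vertices, is its join with `Ω_{n-l(C)}`
(`DiGraph.IsMulticycle.isStar`). That `F_0` is `Ω_n` amounts to the fact that a cycle-free rook
configuration is a disjoint union of directed paths, which can be concatenated to a linear order
(`DiGraph.mem_cycleFreeComplex`). Both filtrations are treated together: each consists of the rook
configurations all of whose edges satisfy a predicate that holds for every edge that is not a loop.

The topological part (`nonempty_quotientSpace_homotopyEquiv`) concerns a complex `K`, some of its
simplices `σ_i`, no two of them in a common face, with stars `σ_i ∗ L_i`, and the subcomplex `K'` of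
the faces that contain no `σ_i`. Write `l_i` for the number of vertices of `σ_i`, and realize the
join `S^{l-1} ∗ |L|` as the set `joinModel l L` of all `(u, w)` in `ℝ^l × cone |L|` with
`‖u‖² + |w|² = 1`.
* The complement of `|K'|` in `|K|` is the disjoint union of the open stars of the `σ_i`. Logarithms
  identify the open simplex `σ_i` with `ℝ^{l_i - 1}`, stereographic projection identifies
  `S^{l_i - 1} \ {e}` with the same space, and so the open star of `σ_i` is homeomorphic to the
  complement of the cone `e ∗ |L_i|` in `S^{l_i - 1} ∗ |L_i|` (`IsStar.homeo`).
* A quotient of a compact Hausdorff space by a closed subset is the one-point compactification of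
  the complement (`Collapse.nonempty_homeomorph_onePoint`). Hence `|K| / |K'|` is the wedge of the
  joins `S^{l_i - 1} ∗ |L_i|` with all the cones `e ∗ |L_i|` collapsed.
* An explicit homotopy of the join contracts the cone `e ∗ |L_i|` to its apex within itself
  (`contraction`), so collapsing the cones does not change the homotopy type
  (`Collapse.nonempty_homotopyEquiv`).

The homeomorphism with the suspensions holds because `joinModel (l + 1) L` is the suspension of
`joinModel l L`, with the poles at `±e` (`suspHomeo`, `iterSuspHomeo`).
-/

noncomputable section

open Topology

/-! ### Collapsing a subspace -/

namespace Collapse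

/-- The quotient map `X → X / A`. -/
def mk {X : Type} (A : Set X) (x : X) : Collapse A := Quot.mk _ (Sum.inr x)

/-- The point of `X / A` to which `A` is collapsed. -/
def pt {X : Type} (A : Set X) : Collapse A := Quot.mk _ (Sum.inl ())

variable {X Y : Type} {A : Set X} {B : Set Y}

theorem mk_of_mem {a : X} (ha : a ∈ A) : mk A a = pt A := Quot.sound ⟨a, ha⟩

@[elab_as_elim]
theorem ind {P : Collapse A → Prop} (h0 : P (pt A)) (h1 : ∀ x, P (mk A x)) (z : Collapse A) :
    P z := by
  induction z using Quot.ind with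
  | mk z => rcases z with ⟨⟨⟩⟩ | x; exacts [h0, h1 x]

/-- The map out of `X / A` induced by a map out of `X` that is constant on `A`. -/
def lift {Z : Type} (f : X → Z) (z : Z) (hf : ∀ a ∈ A, f a = z) : Collapse A → Z :=
  Quot.lift (Sum.elim (fun _ => z) f) (by rintro _ _ ⟨a, ha⟩; exact hf a ha)

variable [TopologicalSpace X] [TopologicalSpace Y]

@[fun_prop]
theorem continuous_mk : Continuous (mk A) :=
  continuous_quot_mk.comp continuous_inr

theorem continuous_lift {Z : Type} [TopologicalSpace Z] {f : X → Z} {z : Z}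
    (hf : ∀ a ∈ A, f a = z) (hc : Continuous f) : Continuous (lift f z hf) :=
  continuous_quot_lift _ (continuous_const.sumElim hc)

instance [CompactSpace X] : CompactSpace (Collapse A) :=
  inferInstanceAs (CompactSpace (Quot _))

/-- A homeomorphism that carries `A` to `B` induces a homeomorphism `X / A ≃ₜ Y / B`. -/
def congr (e : X ≃ₜ Y) (h : ∀ x, x ∈ A ↔ e x ∈ B) : Collapse A ≃ₜ Collapse B where
  toFun := lift (fun x => mk B (e x)) (pt B) fun a ha => mk_of_mem ((h a).1 ha)
  invFun := lift (fun y => mk A (e.symm y)) (pt A) fun b hb => mk_of_mem ((h _).2 (by simpa))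
  left_inv := ind rfl fun x => congrArg (mk A) (e.symm_apply_apply x)
  right_inv := ind rfl fun y => congrArg (mk B) (e.apply_symm_apply y)
  continuous_toFun := continuous_lift _ (by fun_prop)
  continuous_invFun := continuous_lift _ (by fun_prop)

/-- If `A` is a closed subset of a compact Hausdorff space `X`, then `X / A` is the one-point
compactification of the complement of `A`. -/
theorem nonempty_homeomorph_onePoint [CompactSpace X] [T2Space X]
    {Z : Type} [TopologicalSpace Z] {e : Z → X} (he : IsOpenEmbedding e)
    (hr : Set.range e = Aᶜ) : Nonempty (Collapse A ≃ₜ OnePoint Z) := by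
  classical
  have : T2Space Z := he.isEmbedding.t2Space
  have : LocallyCompactSpace Z := he.locallyCompactSpace
  have hdis : ∀ z, e z ∉ A := fun z => by
    have : e z ∈ Aᶜ := hr ▸ Set.mem_range_self z
    exact this
  have hex : ∀ x, x ∉ A → ∃ z, e z = x := fun x hx => by
    have : x ∈ Set.range e := hr ▸ hx
    exact this
  let f : X → OnePoint Z := fun x => if h : x ∈ A then OnePoint.infty else ((hex x h).choose : Z)
  have hfA : ∀ x ∈ A, f x = OnePoint.infty := fun x hx => dif_pos hx
  have hfe : ∀ z, f (e z) = z := fun z => by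
    have h1 : f (e z) = ((hex _ (hdis z)).choose : Z) := dif_neg (hdis z)
    rw [h1]
    exact congrArg _ (he.injective (hex _ (hdis z)).choose_spec)
  have hf : Continuous f := by
    refine ⟨fun s hs => ?_⟩
    by_cases h : OnePoint.infty ∈ s
    · rw [OnePoint.isOpen_iff_of_mem h] at hs
      have : f ⁻¹' s = (e '' ((↑) ⁻¹' s : Set Z)ᶜ)ᶜ := by
        ext x
        by_cases hx : x ∈ A
        · simp only [Set.mem_preimage, hfA x hx, h, true_iff]
          rintro ⟨z, -, rfl⟩
          exact hdis z hx
        · obtain ⟨z, rfl⟩ := hex x hx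
          simp [hfe, he.injective.eq_iff]
      rw [this]
      exact (hs.2.image he.continuous).isClosed.isOpen_compl
    · rw [OnePoint.isOpen_iff_of_notMem h] at hs
      have : f ⁻¹' s = e '' ((↑) ⁻¹' s : Set Z) := by
        ext x
        by_cases hx : x ∈ A
        · simp only [Set.mem_preimage, hfA x hx, h, false_iff]
          rintro ⟨z, -, rfl⟩
          exact hdis z hx
        · obtain ⟨z, rfl⟩ := hex x hx
          simp [hfe, he.injective.eq_iff]
      rw [this]
      exact he.isOpenMap _ hs
  let g : OnePoint Z → Collapse A := fun o => o.elim (pt A) fun z => mk A (e z)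
  let E : Collapse A ≃ OnePoint Z :=
    { toFun := lift f OnePoint.infty hfA
      invFun := g
      left_inv := ind rfl fun x => by
        change g (f x) = mk A x
        by_cases hx : x ∈ A
        · rw [hfA x hx, mk_of_mem hx]; rfl
        · obtain ⟨z, rfl⟩ := hex x hx
          rw [hfe]; rfl
      right_inv := fun o => by
        induction o using OnePoint.rec with
        | infty => rfl
        | coe z => exact hfe z }
  exact ⟨Continuous.homeoOfEquivCompactToT2 (f := E) (continuous_lift hfA hf)⟩

/-- Let `B ⊆ A ⊆ X`. If there is a homotopy of self-maps of `X` that starts at the identity,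
preserves `A` and `B`, and pushes `A` into `B` at its end, then `X / B ≃ₕ X / A`. -/
theorem nonempty_homotopyEquiv {A B : Set X} (hBA : B ⊆ A) (H : C(X, C(I, X)))
    (h0 : ∀ x, H x 0 = x) (hA : ∀ x ∈ A, ∀ t, H x t ∈ A) (hB : ∀ x ∈ B, ∀ t, H x t ∈ B)
    (h1 : ∀ x ∈ A, H x 1 ∈ B) : Nonempty (Collapse B ≃ₕ Collapse A) := by
  let q : C(Collapse B, Collapse A) :=
    ⟨lift (mk A) (pt A) fun b hb => mk_of_mem (hBA hb), continuous_lift _ continuous_mk⟩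
  let r : C(Collapse A, Collapse B) :=
    ⟨lift (fun x => mk B (H x 1)) (pt B) fun a ha => mk_of_mem (h1 a ha),
      continuous_lift _ (by fun_prop)⟩
  -- the homotopy on a quotient `X / S`, curried so that it can be defined by `lift`
  let K : ∀ S : Set X, (∀ x ∈ S, ∀ t, H x t ∈ S) → C(Collapse S, C(I, Collapse S)) :=
    fun S hS => ⟨lift (fun x => (⟨mk S, continuous_mk⟩ : C(X, Collapse S)).comp (H x))
      (ContinuousMap.const I (pt S)) (fun a ha => by ext t; exact mk_of_mem (hS a ha t)),
      continuous_lift _ (by fun_prop)⟩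
  have hom : ∀ (S : Set X) (hS : ∀ x ∈ S, ∀ t, H x t ∈ S) (f : C(Collapse S, Collapse S)),
      (∀ z, K S hS z 1 = f z) → f.Homotopic (ContinuousMap.id _) := fun S hS f hf => by
    refine ContinuousMap.Homotopic.symm ⟨⟨⟨fun p => K S hS p.2 p.1, by fun_prop⟩, ?_, hf⟩⟩
    exact ind rfl fun x => congrArg (mk S) (h0 x)
  exact ⟨q, r, hom B hB _ (ind rfl fun x => rfl), hom A hA _ (ind rfl fun x => rfl)⟩

end Collapse

/-! ### Realizations and cones -/

open Classical in
/-- The support of a function on a finite type. -/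
def supp {V : Type} [Fintype V] (x : V → ℝ) : Finset V := Finset.univ.filter fun v => x v ≠ 0

section
variable {V : Type} [Fintype V]

@[simp]
theorem mem_supp {x : V → ℝ} {v : V} : v ∈ supp x ↔ x v ≠ 0 := by simp [supp]

theorem supp_smul {c : ℝ} (hc : c ≠ 0) (x : V → ℝ) : supp (c • x) = supp x := by
  ext v; simp [hc]

theorem supp_eq_empty {x : V → ℝ} : supp x = ∅ ↔ x = 0 := by
  simp [Finset.eq_empty_iff_forall_notMem, funext_iff]

/-- A point lies in the realization if and only if its support is a face. -/
theorem mem_realization {K : PreAbstractSimplicialComplex V} {x : V → ℝ} :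
    x ∈ realization K ↔ x ∈ stdSimplex ℝ V ∧ supp x ∈ K.faces := by
  refine and_congr_right fun hx => ⟨fun ⟨s, hs, h⟩ => ?_, fun h => ⟨_, h, by simp⟩⟩
  refine (K.isRelLowerSet_faces hs).2 (fun v hv => ?_) ?_
  · by_contra hvs
    exact mem_supp.1 hv (h v hvs)
  · rw [Finset.nonempty_iff_ne_empty, Ne, supp_eq_empty]
    rintro rfl
    simpa using hx.2

theorem isCompact_realization (K : PreAbstractSimplicialComplex V) :
    IsCompact (realization K) := by
  have : realization K = stdSimplex ℝ V ∩ ⋃ s ∈ K.faces, {x | ∀ v, v ∉ s → x v = 0} := by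
    ext x; simp [realization]
  rw [this]
  refine (isCompact_stdSimplex ℝ V).inter_right ?_
  refine (Set.toFinite K.faces).isClosed_biUnion fun s _ => ?_
  simp only [Set.ofPred_forall]
  exact isClosed_iInter fun v => isClosed_iInter fun _ =>
    isClosed_eq (continuous_apply v) continuous_const

instance (K : PreAbstractSimplicialComplex V) : CompactSpace (realization K) :=
  isCompact_iff_compactSpace.1 (isCompact_realization K)

/-- The cone on the realization of `K` with apex the origin: all nonnegative multiples of points
of `|K|`. -/
def coneSet (K : PreAbstractSimplicialComplex V) : Set (V → ℝ) :=
  {w | (∀ v, 0 ≤ w v) ∧ (w = 0 ∨ supp w ∈ K.faces)}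

theorem zero_mem_coneSet (K : PreAbstractSimplicialComplex V) : (0 : V → ℝ) ∈ coneSet K :=
  ⟨fun _ => le_rfl, Or.inl rfl⟩

theorem smul_mem_coneSet {K : PreAbstractSimplicialComplex V} {w : V → ℝ} (hw : w ∈ coneSet K)
    {c : ℝ} (hc : 0 ≤ c) : c • w ∈ coneSet K := by
  rcases hc.eq_or_lt with rfl | hc
  · simpa using zero_mem_coneSet K
  · refine ⟨fun v => mul_nonneg hc.le (hw.1 v), ?_⟩
    rw [supp_smul hc.ne']
    exact hw.2.imp (fun h => by simp [h]) id

theorem mem_realization_iff_coneSet {K : PreAbstractSimplicialComplex V} {x : V → ℝ} :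
    x ∈ realization K ↔ x ∈ coneSet K ∧ ∑ v, x v = 1 := by
  rw [mem_realization]
  constructor
  · exact fun h => ⟨⟨h.1.1, Or.inr h.2⟩, h.1.2⟩
  · rintro ⟨⟨h0, rfl | h⟩, h1⟩
    · simp at h1
    · exact ⟨⟨h0, h1⟩, h⟩

theorem sum_nonneg_of_mem_coneSet {K : PreAbstractSimplicialComplex V} {w : V → ℝ}
    (hw : w ∈ coneSet K) : 0 ≤ ∑ v, w v := Finset.sum_nonneg fun v _ => hw.1 v

theorem sum_eq_zero_of_mem_coneSet {K : PreAbstractSimplicialComplex V} {w : V → ℝ}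
    (hw : w ∈ coneSet K) (h : ∑ v, w v = 0) : w = 0 :=
  funext fun v => (Finset.sum_eq_zero_iff_of_nonneg fun v _ => hw.1 v).1 h v (Finset.mem_univ v)

/-- A subset of `ℝ^l × ℝ^V` that is homeomorphic to both `S^{l-1} ∗ |K|` and `Σ^l |K|`: the points
`(u, w)` with `w` in the cone on `|K|` and `‖u‖² + |w|² = 1`, where `|w|` is the sum of the
coordinates of `w`. -/
def joinModel (l : ℕ) (K : PreAbstractSimplicialComplex V) :
    Set (EuclideanSpace ℝ (Fin l) × (V → ℝ)) :=
  {p | p.2 ∈ coneSet K ∧ ‖p.1‖ ^ 2 + (∑ v, p.2 v) ^ 2 = 1}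

end

/-! ### The join of a sphere with a complex -/

namespace Join

variable {X Y : Type}

/-- The inclusion of the second factor in the join. -/
def inr (y : Y) : Join X Y := Quot.mk _ (Sum.inr (Sum.inr y))

/-- The point of the join at time `t` on the segment from `x` to `y`. -/
def mid (x : X) (y : Y) (t : I) : Join X Y := Quot.mk _ (Sum.inl (x, y, t))

@[elab_as_elim]
theorem ind {P : Join X Y → Prop} (hl : ∀ x, P (inl x)) (hr : ∀ y, P (inr y))
    (hm : ∀ x y t, 0 < t → t < 1 → P (mid x y t)) (z : Join X Y) : P z := by
  induction z using Quot.ind with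
  | mk z =>
    rcases z with ⟨x, y, t⟩ | x | y
    · rcases eq_or_ne t 0 with rfl | h0
      · have : mid x y 0 = inl x := Quot.sound (Join.Rel.left x y)
        change P (mid x y 0)
        rw [this]; exact hl x
      rcases eq_or_ne t 1 with rfl | h1
      · have : mid x y 1 = inr y := Quot.sound (Join.Rel.right x y)
        change P (mid x y 1)
        rw [this]; exact hr y
      exact hm x y t (unitInterval.pos_iff_ne_zero.2 h0) (unitInterval.lt_one_iff_ne_one.2 h1)
    · exact hl x
    · exact hr y

instance [TopologicalSpace X] [TopologicalSpace Y] [CompactSpace X] [CompactSpace Y] :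
    CompactSpace (Join X Y) := inferInstanceAs (CompactSpace (Quot _))

end Join

section
variable {V : Type} [Fintype V]

/-- The map `S^{l-1} ∗ |K| → joinModel l K` that sends the point at time `t` on the segment from
`x` to `y` to `(cos (π t / 2) x, sin (π t / 2) y)`. -/
def joinToModel (l : ℕ) (K : PreAbstractSimplicialComplex V) :
    Join (unitSphere l) (realization K) → joinModel l K :=
  Quot.lift (Sum.elim
    (fun p => ⟨(Real.cos (Real.pi / 2 * p.2.2) • (p.1 : EuclideanSpace ℝ (Fin l)),
        Real.sin (Real.pi / 2 * p.2.2) • (p.2.1 : V → ℝ)),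
      smul_mem_coneSet (mem_realization_iff_coneSet.1 p.2.1.2).1
        (Real.sin_nonneg_of_nonneg_of_le_pi (by have := p.2.2.2.1; positivity)
          (by nlinarith [p.2.2.2.2, Real.pi_pos])), by
        have h1 : ‖(p.1 : EuclideanSpace ℝ (Fin l))‖ = 1 := mem_sphere_zero_iff_norm.1 p.1.2
        have h2 := (mem_realization_iff_coneSet.1 p.2.1.2).2
        simp [norm_smul, h1, ← Finset.mul_sum, h2]⟩)
    (Sum.elim
      (fun x => ⟨(x, 0), zero_mem_coneSet K, by
        simp [mem_sphere_zero_iff_norm.1 x.2]⟩)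
      (fun y => ⟨(0, y), (mem_realization_iff_coneSet.1 y.2).1, by
        simp [(mem_realization_iff_coneSet.1 y.2).2]⟩))) (by
    rintro _ _ (⟨x, y⟩ | ⟨x, y⟩) <;> simp)

theorem continuous_joinToModel (l : ℕ) (K : PreAbstractSimplicialComplex V) :
    Continuous (joinToModel l K) := by
  refine continuous_quot_lift _ (Continuous.sumElim ?_ (Continuous.sumElim ?_ ?_)) <;> fun_prop

theorem joinToModel_inl {l : ℕ} {K : PreAbstractSimplicialComplex V} (x : unitSphere l) :
    (joinToModel l K (Join.inl x)).1 = ((x : EuclideanSpace ℝ (Fin l)), 0) := rfl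

theorem joinToModel_inr {l : ℕ} {K : PreAbstractSimplicialComplex V} (y : realization K) :
    (joinToModel l K (Join.inr y)).1 = (0, (y : V → ℝ)) := rfl

theorem joinToModel_mid {l : ℕ} {K : PreAbstractSimplicialComplex V} (x : unitSphere l)
    (y : realization K) (t : I) :
    (joinToModel l K (Join.mid x y t)).1 =
      (Real.cos (Real.pi / 2 * t) • (x : EuclideanSpace ℝ (Fin l)),
        Real.sin (Real.pi / 2 * t) • (y : V → ℝ)) := rfl

theorem injective_joinToModel (l : ℕ) (K : PreAbstractSimplicialComplex V) :
    Function.Injective (joinToModel l K) := by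
  -- the total weight of the second coordinate tells the two ends from the points between them
  let r : joinModel l K → ℝ := fun p => ∑ v, p.1.2 v
  have rl : ∀ x, r (joinToModel l K (Join.inl x)) = 0 := fun x => by
    simp [r, joinToModel_inl]
  have rr : ∀ y, r (joinToModel l K (Join.inr y)) = 1 := fun y => by
    simp [r, joinToModel_inr, (mem_realization_iff_coneSet.1 y.2).2]
  have rm : ∀ x y t, r (joinToModel l K (Join.mid x y t)) = Real.sin (Real.pi / 2 * t) :=
    fun x y t => by
      simp [r, joinToModel_mid, ← Finset.mul_sum, (mem_realization_iff_coneSet.1 y.2).2]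
  have hs : ∀ t : I, 0 < t → t < 1 → 0 < Real.sin (Real.pi / 2 * t) := fun t h0 h1 =>
    have h0' : (0 : ℝ) < t := h0
    have h1' : (t : ℝ) < 1 := h1
    Real.sin_pos_of_pos_of_lt_pi (by positivity) (by nlinarith [Real.pi_pos])
  have hc : ∀ t : I, 0 < t → t < 1 → 0 < Real.cos (Real.pi / 2 * t) := fun t h0 h1 =>
    have h0' : (0 : ℝ) < t := h0
    have h1' : (t : ℝ) < 1 := h1
    Real.cos_pos_of_mem_Ioo ⟨by nlinarith [Real.pi_pos], by nlinarith [Real.pi_pos]⟩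
  have hs1 : ∀ t : I, 0 < t → t < 1 → Real.sin (Real.pi / 2 * t) ≠ 1 := fun t h0 h1 h => by
    have := Real.sin_sq_add_cos_sq (Real.pi / 2 * t)
    have := hc t h0 h1
    nlinarith
  intro a b hab
  have hr : r (joinToModel l K a) = r (joinToModel l K b) := by rw [hab]
  have hv := congrArg Subtype.val hab
  induction a using Join.ind with
  | hl x =>
    induction b using Join.ind with
    | hl x' => exact congrArg Join.inl (Subtype.ext (congrArg Prod.fst hv))
    | hr y' => rw [rl, rr] at hr; exact absurd hr (by norm_num)
    | hm x' y' t' h0 h1 => rw [rl, rm] at hr; exact absurd hr (hs t' h0 h1).ne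
  | hr y =>
    induction b using Join.ind with
    | hl x' => rw [rl, rr] at hr; exact absurd hr (by norm_num)
    | hr y' => exact congrArg Join.inr (Subtype.ext (congrArg Prod.snd hv))
    | hm x' y' t' h0 h1 => rw [rr, rm] at hr; exact absurd hr.symm (hs1 t' h0 h1)
  | hm x y t h0 h1 =>
    induction b using Join.ind with
    | hl x' => rw [rl, rm] at hr; exact absurd hr (hs t h0 h1).ne'
    | hr y' => rw [rr, rm] at hr; exact absurd hr (hs1 t h0 h1)
    | hm x' y' t' h0' h1' =>
      rw [rm, rm] at hr
      have hpi := Real.pi_pos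
      have ht : t = t' := by
        have := Real.injOn_sin ⟨by nlinarith [t.2.1], by nlinarith [t.2.2]⟩
          ⟨by nlinarith [t'.2.1], by nlinarith [t'.2.2]⟩ hr
        exact Subtype.ext (mul_left_cancel₀ (by positivity) this)
      subst ht
      rw [joinToModel_mid, joinToModel_mid, Prod.mk.injEq] at hv
      rw [show x = x' from Subtype.ext (smul_right_injective _ (hc t h0 h1).ne' hv.1),
        show y = y' from Subtype.ext (smul_right_injective _ (hs t h0 h1).ne' hv.2)]

theorem surjective_joinToModel (l : ℕ) (K : PreAbstractSimplicialComplex V) :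
    Function.Surjective (joinToModel l K) := by
  rintro ⟨⟨u, w⟩, hw, h⟩
  simp only at hw h
  have hr0 := sum_nonneg_of_mem_coneSet hw
  set r := ∑ v, w v with hr
  rcases eq_or_ne r 0 with h0 | h0
  · have hw0 := sum_eq_zero_of_mem_coneSet hw h0
    refine ⟨Join.inl ⟨u, ?_⟩, Subtype.ext (Prod.ext rfl hw0.symm)⟩
    rw [h0] at h
    exact mem_sphere_zero_iff_norm.2 ((pow_eq_one_iff_of_nonneg (norm_nonneg u)
      two_ne_zero).1 (by linarith))
  rcases eq_or_ne u 0 with rfl | hu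
  · refine ⟨Join.inr ⟨w, mem_realization_iff_coneSet.2 ⟨hw, ?_⟩⟩, rfl⟩
    exact (pow_eq_one_iff_of_nonneg hr0 two_ne_zero).1 (by simpa using h)
  have hup : 0 < ‖u‖ := norm_pos_iff.2 hu
  have hrp : 0 < r := lt_of_le_of_ne hr0 h0.symm
  have hpi := Real.pi_pos
  have hr1 : r ≤ 1 := by nlinarith
  have hmul : Real.pi / 2 * (2 / Real.pi * Real.arcsin r) = Real.arcsin r := by field_simp
  have ht : 2 / Real.pi * Real.arcsin r ∈ I := by
    have h2 := Real.arcsin_le_pi_div_two r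
    have h3 : 0 ≤ Real.arcsin r := Real.arcsin_nonneg.2 hr0
    refine ⟨by positivity, ?_⟩
    rw [← mul_le_mul_iff_right₀ (show 0 < Real.pi / 2 by positivity), hmul]
    linarith
  refine ⟨Join.mid ⟨‖u‖⁻¹ • u, ?_⟩ ⟨r⁻¹ • w, ?_⟩ ⟨_, ht⟩, Subtype.ext ?_⟩
  · simp [norm_smul, hup.ne']
  · refine mem_realization_iff_coneSet.2 ⟨smul_mem_coneSet hw (by positivity), ?_⟩
    simp [← Finset.mul_sum, ← hr, h0]
  · have hcos : Real.cos (Real.arcsin r) = ‖u‖ := by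
      rw [Real.cos_arcsin, ← h, add_sub_cancel_right, Real.sqrt_sq hup.le]
    rw [joinToModel_mid]
    simp only [hmul, hcos, Real.sin_arcsin (by linarith) hr1, smul_smul, mul_inv_cancel₀ hup.ne',
      mul_inv_cancel₀ h0, one_smul]

/-- The join of the sphere `S^{l-1}` with `|K|` is homeomorphic to `joinModel l K`. -/
def joinHomeo (l : ℕ) (K : PreAbstractSimplicialComplex V) :
    Join (unitSphere l) (realization K) ≃ₜ joinModel l K :=
  Continuous.homeoOfEquivCompactToT2
    (f := Equiv.ofBijective _ ⟨injective_joinToModel l K, surjective_joinToModel l K⟩)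
    (continuous_joinToModel l K)

theorem joinHomeo_inl {l : ℕ} {K : PreAbstractSimplicialComplex V} (x : unitSphere l) :
    (joinHomeo l K (Join.inl x)).1 = ((x : EuclideanSpace ℝ (Fin l)), 0) := rfl

instance (l : ℕ) (K : PreAbstractSimplicialComplex V) : CompactSpace (joinModel l K) :=
  (joinHomeo l K).compactSpace

end

/-! ### The iterated suspension of a complex -/

namespace Susp

variable {X : Type}

/-- The pole `S` of a suspension. -/
def southPole (X : Type) : Susp X := Quot.mk _ (Sum.inr false)

/-- The point of the suspension at time `t` on the segment from `N` to `S` through `x`. -/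
def mid (x : X) (t : I) : Susp X := Quot.mk _ (Sum.inl (x, t))

@[elab_as_elim]
theorem ind {P : Susp X → Prop} (hn : P (pole X)) (hs : P (southPole X))
    (hm : ∀ x t, 0 < t → t < 1 → P (mid x t)) (z : Susp X) : P z := by
  induction z using Quot.ind with
  | mk z =>
    rcases z with ⟨x, t⟩ | ⟨_ | _⟩
    · rcases eq_or_ne t 0 with rfl | h0
      · have : mid x 0 = pole X := Quot.sound (Susp.Rel.north x)
        change P (mid x 0)
        rw [this]; exact hn
      rcases eq_or_ne t 1 with rfl | h1
      · have : mid x 1 = southPole X := Quot.sound (Susp.Rel.south x)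
        change P (mid x 1)
        rw [this]; exact hs
      exact hm x t (unitInterval.pos_iff_ne_zero.2 h0) (unitInterval.lt_one_iff_ne_one.2 h1)
    · exact hs
    · exact hn

instance [TopologicalSpace X] [CompactSpace X] : CompactSpace (Susp X) :=
  inferInstanceAs (CompactSpace (Quot _))

variable {Y : Type}

/-- The map of suspensions induced by a map of spaces. -/
def map (f : X → Y) : Susp X → Susp Y :=
  Quot.map (Sum.map (Prod.map f id) id) (by
    rintro _ _ (x | x); exacts [Susp.Rel.north _, Susp.Rel.south _])

variable [TopologicalSpace X] [TopologicalSpace Y]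

theorem continuous_map {f : X → Y} (hf : Continuous f) : Continuous (map f) :=
  continuous_quot_lift _ (continuous_quot_mk.comp (by fun_prop))

/-- Homeomorphic spaces have homeomorphic suspensions. -/
def congr (e : X ≃ₜ Y) : Susp X ≃ₜ Susp Y where
  toFun := map e
  invFun := map e.symm
  left_inv := ind rfl rfl fun x t _ _ => congrArg (mid · t) (e.symm_apply_apply x)
  right_inv := ind rfl rfl fun x t _ _ => congrArg (mid · t) (e.apply_symm_apply x)
  continuous_toFun := continuous_map e.continuous
  continuous_invFun := continuous_map e.symm.continuous

end Susp

/-- The vector of `ℝ^{l+1}` with first coordinate `c` and remaining coordinates `u`. -/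
def consVec {l : ℕ} (c : ℝ) (u : EuclideanSpace ℝ (Fin l)) : EuclideanSpace ℝ (Fin (l + 1)) :=
  WithLp.toLp 2 (Fin.cons c u)

section
variable {l : ℕ}

@[fun_prop]
theorem Continuous.consVec {X : Type} [TopologicalSpace X] {f : X → ℝ}
    {g : X → EuclideanSpace ℝ (Fin l)} (hf : Continuous f) (hg : Continuous g) :
    Continuous fun x => consVec (f x) (g x) := by
  refine (PiLp.continuous_toLp 2 _).comp (continuous_pi fun i => ?_)
  induction i using Fin.cases with
  | zero => exact hf
  | succ i =>
    simp only [Fin.cons_succ]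
    fun_prop

@[simp]
theorem consVec_zero (c : ℝ) (u : EuclideanSpace ℝ (Fin l)) : consVec c u 0 = c := rfl

@[simp]
theorem consVec_succ (c : ℝ) (u : EuclideanSpace ℝ (Fin l)) (i : Fin l) :
    consVec c u i.succ = u i := rfl

theorem norm_consVec_sq (c : ℝ) (u : EuclideanSpace ℝ (Fin l)) :
    ‖consVec c u‖ ^ 2 = c ^ 2 + ‖u‖ ^ 2 := by
  simp [EuclideanSpace.real_norm_sq_eq, Fin.sum_univ_succ]

theorem exists_eq_consVec (u : EuclideanSpace ℝ (Fin (l + 1))) : ∃ c v, consVec c v = u :=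
  ⟨u 0, WithLp.toLp 2 fun i => u i.succ, by
    ext i; induction i using Fin.cases <;> rfl⟩

theorem consVec_inj {c c' : ℝ} {u u' : EuclideanSpace ℝ (Fin l)} :
    consVec c u = consVec c' u' ↔ c = c' ∧ u = u' := by
  refine ⟨fun h => ⟨congrArg (fun v => v 0) h, ?_⟩, fun h => by rw [h.1, h.2]⟩
  ext i
  exact congrArg (fun v => v i.succ) h

theorem consVec_one_zero : consVec 1 0 = (spherePoint (l + 1) l.succ_pos).1 := by
  ext i
  induction i using Fin.cases <;> simp [spherePoint, consVec]

variable {V : Type} [Fintype V]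

/-- The map `Σ (joinModel l K) → joinModel (l + 1) K` that sends the point at time `t` on the
segment through `(u, w)` to `((cos (π t), sin (π t) u), sin (π t) w)`. -/
def suspToModel (l : ℕ) (K : PreAbstractSimplicialComplex V) :
    Susp (joinModel l K) → joinModel (l + 1) K :=
  Quot.lift (Sum.elim
    (fun p => ⟨(consVec (Real.cos (Real.pi * p.2)) (Real.sin (Real.pi * p.2) • p.1.1.1),
        Real.sin (Real.pi * p.2) • p.1.1.2),
      smul_mem_coneSet p.1.2.1
        (Real.sin_nonneg_of_nonneg_of_le_pi (by have := p.2.2.1; positivity)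
          (by nlinarith [p.2.2.2, Real.pi_pos])), by
        have h1 := p.1.2.2
        simp only [norm_consVec_sq, norm_smul, mul_pow, Real.norm_eq_abs, sq_abs, Pi.smul_apply,
          smul_eq_mul, ← Finset.mul_sum]
        rw [add_assoc, ← mul_add, h1, mul_one, Real.cos_sq_add_sin_sq]⟩)
    (fun b => ⟨(consVec (if b then 1 else -1) 0, 0), zero_mem_coneSet K, by
        cases b <;> simp [norm_consVec_sq]⟩)) (by
    rintro _ _ (x | x) <;> simp)

theorem continuous_suspToModel (l : ℕ) (K : PreAbstractSimplicialComplex V) :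
    Continuous (suspToModel l K) := by
  refine continuous_quot_lift _ (Continuous.sumElim ?_ continuous_of_discreteTopology)
  fun_prop

theorem suspToModel_pole {K : PreAbstractSimplicialComplex V} :
    (suspToModel l K (Susp.pole _)).1 = (consVec 1 0, 0) := rfl

theorem suspToModel_southPole {K : PreAbstractSimplicialComplex V} :
    (suspToModel l K (Susp.southPole _)).1 = (consVec (-1) 0, 0) := rfl

theorem suspToModel_mid {K : PreAbstractSimplicialComplex V} (p : joinModel l K) (t : I) :
    (suspToModel l K (Susp.mid p t)).1 =
      (consVec (Real.cos (Real.pi * t)) (Real.sin (Real.pi * t) • p.1.1),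
        Real.sin (Real.pi * t) • p.1.2) := rfl

theorem injective_suspToModel (l : ℕ) (K : PreAbstractSimplicialComplex V) :
    Function.Injective (suspToModel l K) := by
  have hs : ∀ t : I, 0 < t → t < 1 → 0 < Real.sin (Real.pi * t) := fun t h0 h1 =>
    have h0' : (0 : ℝ) < t := h0
    have h1' : (t : ℝ) < 1 := h1
    have hpi := Real.pi_pos
    Real.sin_pos_of_pos_of_lt_pi (by positivity) (by nlinarith)
  have hc : ∀ t : I, 0 < t → t < 1 → Real.cos (Real.pi * t) ^ 2 < 1 := fun t h0 h1 => by
    have := Real.sin_sq_add_cos_sq (Real.pi * t)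
    have := hs t h0 h1
    nlinarith
  intro a b hab
  have hv := congrArg Subtype.val hab
  -- the first coordinate is the height in the suspension
  have hr := congrArg (fun p : EuclideanSpace ℝ (Fin (l + 1)) × (V → ℝ) => p.1 0) hv
  induction a using Susp.ind with
  | hn =>
    induction b using Susp.ind with
    | hn => rfl
    | hs => norm_num [suspToModel_pole, suspToModel_southPole] at hr
    | hm p t h0 h1 =>
      simp only [suspToModel_pole, suspToModel_mid, consVec_zero] at hr
      have := hc t h0 h1
      norm_num [← hr] at this
  | hs =>
    induction b using Susp.ind with
    | hn => norm_num [suspToModel_pole, suspToModel_southPole] at hr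
    | hs => rfl
    | hm p t h0 h1 =>
      simp only [suspToModel_southPole, suspToModel_mid, consVec_zero] at hr
      have := hc t h0 h1
      norm_num [← hr] at this
  | hm p t h0 h1 =>
    induction b using Susp.ind with
    | hn =>
      simp only [suspToModel_pole, suspToModel_mid, consVec_zero] at hr
      have := hc t h0 h1
      norm_num [hr] at this
    | hs =>
      simp only [suspToModel_southPole, suspToModel_mid, consVec_zero] at hr
      have := hc t h0 h1
      norm_num [hr] at this
    | hm p' t' h0' h1' =>
      simp only [suspToModel_mid, consVec_zero] at hr
      have hpi := Real.pi_pos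
      have ht : t = t' := by
        have := Real.injOn_cos ⟨by nlinarith [t.2.1], by nlinarith [t.2.2]⟩
          ⟨by nlinarith [t'.2.1], by nlinarith [t'.2.2]⟩ hr
        exact Subtype.ext (mul_left_cancel₀ hpi.ne' this)
      subst ht
      rw [suspToModel_mid, suspToModel_mid, Prod.mk.injEq, consVec_inj] at hv
      have hst := (hs t h0 h1).ne'
      rw [show p = p' from Subtype.ext (Prod.ext (smul_right_injective _ hst hv.1.2)
        (smul_right_injective _ hst hv.2))]

theorem surjective_suspToModel (l : ℕ) (K : PreAbstractSimplicialComplex V) :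
    Function.Surjective (suspToModel l K) := by
  rintro ⟨⟨u, w⟩, hw, h⟩
  obtain ⟨c, u, rfl⟩ := exists_eq_consVec u
  simp only [norm_consVec_sq] at hw h
  have hr0 := sum_nonneg_of_mem_coneSet hw
  have hpi := Real.pi_pos
  have hcs : c ^ 2 ≤ 1 := by nlinarith [sq_nonneg ‖u‖, sq_nonneg (∑ v, w v)]
  rcases hcs.eq_or_lt with hc | hc
  · have hu : u = 0 := by
      rw [← norm_eq_zero, ← sq_eq_zero_iff]
      nlinarith [sq_nonneg ‖u‖, sq_nonneg (∑ v, w v)]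
    have hw0 : w = 0 := by
      refine sum_eq_zero_of_mem_coneSet hw ?_
      rw [← sq_eq_zero_iff]
      nlinarith [sq_nonneg ‖u‖, sq_nonneg (∑ v, w v)]
    subst hu hw0
    rcases (mul_self_eq_one_iff.1 ((sq c).symm.trans hc)) with rfl | rfl
    · exact ⟨Susp.pole _, rfl⟩
    · exact ⟨Susp.southPole _, rfl⟩
  · have hc1 : -1 ≤ c := by nlinarith
    have hc2 : c ≤ 1 := by nlinarith
    set s := √(1 - c ^ 2) with hs
    have hsp : 0 < s := Real.sqrt_pos.2 (by linarith)
    have hs2 : s ^ 2 = 1 - c ^ 2 := Real.sq_sqrt (by linarith)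
    have hmul : Real.pi * (Real.arccos c / Real.pi) = Real.arccos c := by field_simp
    have ht : Real.arccos c / Real.pi ∈ I :=
      ⟨div_nonneg (Real.arccos_nonneg c) hpi.le, (div_le_one hpi).2 (Real.arccos_le_pi c)⟩
    refine ⟨Susp.mid ⟨(s⁻¹ • u, s⁻¹ • w), smul_mem_coneSet hw (by positivity), ?_⟩ ⟨_, ht⟩,
      Subtype.ext ?_⟩
    · simp only [norm_smul, Real.norm_eq_abs, mul_pow, sq_abs, Pi.smul_apply, smul_eq_mul,
        ← Finset.mul_sum]
      rw [← mul_add, inv_pow, hs2, inv_mul_eq_one₀ (by linarith)]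
      linarith
    · rw [suspToModel_mid]
      simp only [hmul, Real.cos_arccos hc1 hc2, Real.sin_arccos, ← hs, smul_smul,
        mul_inv_cancel₀ hsp.ne', one_smul]

/-- The suspension of `joinModel l K` is homeomorphic to `joinModel (l + 1) K`. -/
def suspHomeo (l : ℕ) (K : PreAbstractSimplicialComplex V) :
    Susp (joinModel l K) ≃ₜ joinModel (l + 1) K :=
  Continuous.homeoOfEquivCompactToT2
    (f := Equiv.ofBijective _ ⟨injective_suspToModel l K, surjective_suspToModel l K⟩)
    (continuous_suspToModel l K)

/-- `|K|` is homeomorphic to `joinModel 0 K`. -/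
def realizationHomeo (K : PreAbstractSimplicialComplex V) : realization K ≃ₜ joinModel 0 K where
  toFun x := ⟨(0, x), (mem_realization_iff_coneSet.1 x.2).1, by
    simp [(mem_realization_iff_coneSet.1 x.2).2]⟩
  invFun p := ⟨p.1.2, mem_realization_iff_coneSet.2 ⟨p.2.1,
    (pow_eq_one_iff_of_nonneg (sum_nonneg_of_mem_coneSet p.2.1) two_ne_zero).1 (by
      have h := p.2.2
      rwa [Subsingleton.elim p.1.1 0, norm_zero, zero_pow two_ne_zero, zero_add] at h)⟩⟩
  left_inv _ := rfl
  right_inv p := Subtype.ext (Prod.ext (Subsingleton.elim _ _) rfl)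
  continuous_toFun := by fun_prop
  continuous_invFun := by fun_prop

/-- The `l`-fold suspension of `|K|` is homeomorphic to `joinModel l K`. -/
def iterSuspHomeo (K : PreAbstractSimplicialComplex V) :
    ∀ l : ℕ, iterSusp l (TopCat.of (realization K)) ≃ₜ joinModel l K
  | 0 => realizationHomeo K
  | l + 1 => (Susp.congr (iterSuspHomeo K l)).trans (suspHomeo l K)

theorem iterSuspHomeo_pole (K : PreAbstractSimplicialComplex V) :
    ∀ (l : ℕ) (h : 0 < l), (iterSuspHomeo K l (iterSuspPole l h _)).1 = (↑(spherePoint l h), 0)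
  | l + 1, _ => by
    rw [← consVec_one_zero]
    rfl

/-- The homeomorphism between the join `S^{l-1} ∗ |K|` and the suspension `Σ^l |K|`. -/
def joinHomeoIterSusp (l : ℕ) (K : PreAbstractSimplicialComplex V) :
    Join (unitSphere l) (realization K) ≃ₜ iterSusp l (TopCat.of (realization K)) :=
  (joinHomeo l K).trans (iterSuspHomeo K l).symm

theorem joinHomeoIterSusp_inl (l : ℕ) (h : 0 < l) (K : PreAbstractSimplicialComplex V) :
    joinHomeoIterSusp l K (Join.inl (spherePoint l h)) = iterSuspPole l h _ := by
  refine (iterSuspHomeo K l).symm_apply_eq.2 (Subtype.ext ?_)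
  rw [iterSuspHomeo_pole]
  exact joinHomeo_inl _

end

/-- A fibrewise homeomorphism of disjoint unions. -/
def sigmaHomeo {ι : Type} {X Y : ι → Type} [∀ i, TopologicalSpace (X i)]
    [∀ i, TopologicalSpace (Y i)] (e : ∀ i, X i ≃ₜ Y i) : (Σ i, X i) ≃ₜ Σ i, Y i where
  toEquiv := Equiv.sigmaCongrRight fun i => (e i).toEquiv
  continuous_toFun := continuous_sigma fun i => continuous_sigmaMk.comp (e i).continuous
  continuous_invFun := continuous_sigma fun i => continuous_sigmaMk.comp (e i).symm.continuous

theorem sigmaHomeo_apply {ι : Type} {X Y : ι → Type} [∀ i, TopologicalSpace (X i)]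
    [∀ i, TopologicalSpace (Y i)] (e : ∀ i, X i ≃ₜ Y i) (p : Σ i, X i) :
    sigmaHomeo e p = ⟨p.1, e p.1 p.2⟩ := rfl

/-- Wedges of homeomorphic pointed spaces are homeomorphic. -/
def wedgeCongr {ι : Type} {X Y : ι → Type} [∀ i, TopologicalSpace (X i)]
    [∀ i, TopologicalSpace (Y i)] {x : ∀ i, X i} {y : ∀ i, Y i} (e : ∀ i, X i ≃ₜ Y i)
    (h : ∀ i, e i (x i) = y i) : Wedge X x ≃ₜ Wedge Y y :=
  Collapse.congr (sigmaHomeo e) fun ⟨i, z⟩ => by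
    constructor
    · rintro ⟨j, hj⟩
      obtain rfl : j = i := congrArg Sigma.fst hj
      obtain rfl : x j = z := by simpa using hj
      exact ⟨j, by simp [← h, sigmaHomeo_apply]⟩
    · rintro ⟨j, hj⟩
      obtain rfl : j = i := congrArg Sigma.fst hj
      obtain hz : y j = e j z := by simpa [sigmaHomeo_apply] using hj
      rw [← h, (e j).injective.eq_iff] at hz
      exact ⟨j, by simp [hz]⟩

/-! ### Contracting a cone inside the join -/

section
variable {V : Type} [Fintype V] {l : ℕ}

/-- The norm on `ℝ^l × ℝ^V` whose unit vectors in `ℝ^l × coneSet K` form `joinModel l K`. -/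
def modelNorm (q : EuclideanSpace ℝ (Fin l) × (V → ℝ)) : ℝ :=
  √(‖q.1‖ ^ 2 + (∑ v, q.2 v) ^ 2)

theorem continuous_modelNorm :
    Continuous (modelNorm : EuclideanSpace ℝ (Fin l) × (V → ℝ) → ℝ) := by
  unfold modelNorm
  fun_prop

theorem modelNorm_smul {c : ℝ} (hc : 0 ≤ c) (q : EuclideanSpace ℝ (Fin l) × (V → ℝ)) :
    modelNorm (c • q) = c * modelNorm q := by
  simp only [modelNorm, Prod.smul_fst, Prod.smul_snd, norm_smul, Real.norm_eq_abs, mul_pow,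
    sq_abs, Pi.smul_apply, smul_eq_mul, ← Finset.mul_sum]
  rw [← mul_add, Real.sqrt_mul (sq_nonneg c), Real.sqrt_sq hc]

theorem modelNorm_eq_one {K : PreAbstractSimplicialComplex V} (p : joinModel l K) :
    modelNorm p.1 = 1 := by
  rw [modelNorm, p.2.2, Real.sqrt_one]

theorem modelNorm_pos {K : PreAbstractSimplicialComplex V}
    {q : EuclideanSpace ℝ (Fin l) × (V → ℝ)} (hq : q.2 ∈ coneSet K) (h0 : q ≠ 0) :
    0 < modelNorm q := by
  refine Real.sqrt_pos.2 (lt_of_le_of_ne (by positivity) fun h => h0 ?_)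
  have h1 : ‖q.1‖ ^ 2 = 0 := by nlinarith [sq_nonneg ‖q.1‖, sq_nonneg (∑ v, q.2 v)]
  have h2 : (∑ v, q.2 v) ^ 2 = 0 := by nlinarith [sq_nonneg ‖q.1‖, sq_nonneg (∑ v, q.2 v)]
  exact Prod.ext (norm_eq_zero.1 (pow_eq_zero_iff two_ne_zero |>.1 h1))
    (sum_eq_zero_of_mem_coneSet hq (pow_eq_zero_iff two_ne_zero |>.1 h2))

/-- The radial projection of a nonzero point of `ℝ^l × coneSet K` to `joinModel l K`. -/
def toModel {K : PreAbstractSimplicialComplex V} (q : EuclideanSpace ℝ (Fin l) × (V → ℝ))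
    (hq : q.2 ∈ coneSet K) (h0 : q ≠ 0) : joinModel l K :=
  ⟨(modelNorm q)⁻¹ • q, smul_mem_coneSet hq (inv_nonneg.2 (modelNorm_pos hq h0).le), by
    have hp := modelNorm_pos hq h0
    have h1 := modelNorm_smul (inv_nonneg.2 hp.le) q
    rw [inv_mul_cancel₀ hp.ne'] at h1
    exact Real.sqrt_eq_one.1 h1⟩

theorem toModel_smul {K : PreAbstractSimplicialComplex V} (p : joinModel l K) {c : ℝ}
    (hc : 0 < c) (hq : (c • p.1).2 ∈ coneSet K) (h0 : c • p.1 ≠ 0) :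
    toModel (c • p.1) hq h0 = p := by
  refine Subtype.ext ?_
  change (modelNorm (c • p.1))⁻¹ • c • p.1 = p.1
  rw [modelNorm_smul hc.le, modelNorm_eq_one, mul_one, inv_smul_smul₀ hc.ne']

theorem toModel_eq {K : PreAbstractSimplicialComplex V} (p : joinModel l K)
    {q : EuclideanSpace ℝ (Fin l) × (V → ℝ)} (hq : q.2 ∈ coneSet K) (h0 : q ≠ 0) {c : ℝ}
    (hc : 0 < c) (h : q = c • p.1) : toModel q hq h0 = p := by
  subst h
  exact toModel_smul p hc hq h0

theorem ne_zero_of_joinModel {K : PreAbstractSimplicialComplex V} (p : joinModel l K) :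
    p.1 ≠ 0 := by
  intro h
  have := p.2.2
  simp [h] at this

/-- The join of the basis vector `e_z ∈ S^{l-1}` with `|K|`: the points `(u, w)` for which `u` is a
nonnegative multiple of `e_z`, that is, `‖u‖ ≤ u_z`. -/
def poleCone (l : ℕ) (K : PreAbstractSimplicialComplex V) (z : Fin l) : Set (joinModel l K) :=
  {p | ‖p.1.1‖ ≤ p.1.1 z}

/-- The basis vector `e_z ∈ S^{l-1}` as a point of the join. -/
def modelPole (K : PreAbstractSimplicialComplex V) (z : Fin l) : joinModel l K :=
  ⟨(EuclideanSpace.single z 1, 0), zero_mem_coneSet K, by simp⟩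

theorem modelPole_mem_poleCone (K : PreAbstractSimplicialComplex V) (z : Fin l) :
    modelPole K z ∈ poleCone l K z := by
  simp [poleCone, modelPole]

theorem apply_le_norm (u : EuclideanSpace ℝ (Fin l)) (z : Fin l) : u z ≤ ‖u‖ :=
  (le_abs_self _).trans (PiLp.norm_apply_le u z)

theorem eq_smul_single_of_norm_le {u : EuclideanSpace ℝ (Fin l)} {z : Fin l} (h : ‖u‖ ≤ u z) :
    u = ‖u‖ • EuclideanSpace.single z 1 := by
  have hz : u z = ‖u‖ := le_antisymm (apply_le_norm u z) h
  have hsum : ∑ i ∈ Finset.univ.erase z, u i ^ 2 = 0 := by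
    have h1 := EuclideanSpace.real_norm_sq_eq u
    rw [← Finset.add_sum_erase _ _ (Finset.mem_univ z), hz] at h1
    linarith
  rw [Finset.sum_eq_zero_iff_of_nonneg fun i _ => sq_nonneg _] at hsum
  ext i
  rcases eq_or_ne i z with rfl | hi
  · simp [hz]
  · simpa [hi] using hsum i (by simp [hi])

/-- The point `(u + t |w| e_z, (1 - t + t (‖u‖ - u_z)) w)` for `q = (u, w)`. The factor `‖u‖ - u_z`
vanishes precisely on the cone `poleCone l K z`; so at time `t = 1` the coordinate `w` disappears on
the cone, and only there. -/
def contractionVec (z : Fin l) (q : EuclideanSpace ℝ (Fin l) × (V → ℝ)) (t : ℝ) :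
    EuclideanSpace ℝ (Fin l) × (V → ℝ) :=
  (q.1 + (t * ∑ v, q.2 v) • EuclideanSpace.single z 1, (1 - t + t * (‖q.1‖ - q.1 z)) • q.2)

theorem contraction_factor_nonneg (u : EuclideanSpace ℝ (Fin l)) (z : Fin l) (t : I) :
    0 ≤ 1 - (t : ℝ) + t * (‖u‖ - u z) :=
  add_nonneg (sub_nonneg.2 t.2.2) (mul_nonneg t.2.1 (sub_nonneg.2 (apply_le_norm u z)))

theorem contractionVec_mem {K : PreAbstractSimplicialComplex V} (z : Fin l) (p : joinModel l K)
    (t : I) : (contractionVec z p.1 t).2 ∈ coneSet K :=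
  smul_mem_coneSet p.2.1 (contraction_factor_nonneg _ _ _)

theorem contractionVec_ne_zero {K : PreAbstractSimplicialComplex V} (z : Fin l)
    (p : joinModel l K) (t : I) : contractionVec z p.1 t ≠ 0 := by
  intro h
  have h1 : p.1.1 + ((t : ℝ) * ∑ v, p.1.2 v) • EuclideanSpace.single z 1 = 0 :=
    congrArg Prod.fst h
  have h2 : (1 - (t : ℝ) + t * (‖p.1.1‖ - p.1.1 z)) • p.1.2 = 0 := congrArg Prod.snd h
  have hw : p.1.2 ≠ 0 := fun hw => by
    rw [hw] at h1
    exact ne_zero_of_joinModel p (Prod.ext (by simpa using h1) hw)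
  have hs0 : 0 ≤ ∑ v, p.1.2 v := sum_nonneg_of_mem_coneSet p.2.1
  have hs : 0 < ∑ v, p.1.2 v :=
    lt_of_le_of_ne hs0 fun h => hw (sum_eq_zero_of_mem_coneSet p.2.1 h.symm)
  have h3 := (smul_eq_zero.1 h2).resolve_right hw
  have h4 := apply_le_norm p.1.1 z
  have h5 : p.1.1 z + t * ∑ v, p.1.2 v = 0 := by
    simpa using congrArg (fun u : EuclideanSpace ℝ (Fin l) => u z) h1
  have ht1 : (t : ℝ) = 1 := by
    have := mul_nonneg t.2.1 (sub_nonneg.2 h4)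
    linarith [t.2.2]
  -- now `‖u‖ = u_z` and `u_z = -|w| < 0`
  rw [ht1] at h3 h5
  linarith [norm_nonneg p.1.1]

theorem continuous_contractionVec {X : Type} [TopologicalSpace X] (z : Fin l)
    {f : X → EuclideanSpace ℝ (Fin l) × (V → ℝ)} {g : X → ℝ} (hf : Continuous f)
    (hg : Continuous g) : Continuous fun x => contractionVec z (f x) (g x) := by
  unfold contractionVec
  fun_prop

/-- A homotopy of self-maps of `joinModel l K`, starting at the identity, that shrinks the cone
`poleCone l K z` to its apex within itself. -/
def contraction (K : PreAbstractSimplicialComplex V) (z : Fin l) :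
    C(joinModel l K, C(I, joinModel l K)) :=
  ContinuousMap.curry ⟨fun x => toModel (contractionVec z x.1.1 x.2)
    (contractionVec_mem z x.1 x.2) (contractionVec_ne_zero z x.1 x.2), by
      have hc : Continuous fun x : joinModel l K × I => contractionVec z x.1.1 (x.2 : ℝ) :=
        continuous_contractionVec z (by fun_prop) (by fun_prop)
      refine Continuous.subtype_mk (Continuous.smul (Continuous.inv₀
        (continuous_modelNorm.comp hc) fun x => ?_) hc) _
      exact (modelNorm_pos (contractionVec_mem z x.1 x.2) (contractionVec_ne_zero z x.1 x.2)).ne'⟩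

theorem contraction_zero (K : PreAbstractSimplicialComplex V) (z : Fin l) (p : joinModel l K) :
    contraction K z p 0 = p :=
  toModel_eq p (contractionVec_mem z p 0) (contractionVec_ne_zero z p 0) one_pos (by simp [contractionVec])

theorem contraction_modelPole (K : PreAbstractSimplicialComplex V) (z : Fin l) (t : I) :
    contraction K z (modelPole K z) t = modelPole K z :=
  toModel_eq _ (contractionVec_mem z _ t) (contractionVec_ne_zero z _ t) one_pos
    (by simp [contractionVec, modelPole])

theorem contraction_mem (K : PreAbstractSimplicialComplex V) (z : Fin l) {p : joinModel l K}
    (hp : p ∈ poleCone l K z) (t : I) : contraction K z p t ∈ poleCone l K z := by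
  have hu := eq_smul_single_of_norm_le hp
  set N := modelNorm (contractionVec z p.1 t)
  have hN : 0 < N := modelNorm_pos (contractionVec_mem z p t) (contractionVec_ne_zero z p t)
  have hs : 0 ≤ ∑ v, p.1.2 v := sum_nonneg_of_mem_coneSet p.2.1
  change ‖N⁻¹ • (p.1.1 + ((t : ℝ) * ∑ v, p.1.2 v) • EuclideanSpace.single z 1)‖ ≤
    (N⁻¹ • (p.1.1 + ((t : ℝ) * ∑ v, p.1.2 v) • EuclideanSpace.single z 1) :
      EuclideanSpace ℝ (Fin l)) z
  have ht := t.2.1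
  have h1 : p.1.1 + ((t : ℝ) * ∑ v, p.1.2 v) • EuclideanSpace.single z 1 =
      (‖p.1.1‖ + t * ∑ v, p.1.2 v) • EuclideanSpace.single z (1 : ℝ) := by
    rw [add_smul, ← hu]
  have h2 : 0 ≤ N⁻¹ * (‖p.1.1‖ + t * ∑ v, p.1.2 v) := by positivity
  rw [h1, smul_smul, norm_smul, Real.norm_of_nonneg h2]
  simp

theorem contraction_one (K : PreAbstractSimplicialComplex V) (z : Fin l) {p : joinModel l K}
    (hp : p ∈ poleCone l K z) : contraction K z p 1 = modelPole K z := by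
  have hu := eq_smul_single_of_norm_le hp
  have hz : p.1.1 z = ‖p.1.1‖ := le_antisymm (apply_le_norm _ z) hp
  have hs : 0 ≤ ∑ v, p.1.2 v := sum_nonneg_of_mem_coneSet p.2.1
  have hc : 0 < ‖p.1.1‖ + ∑ v, p.1.2 v := by
    refine lt_of_le_of_ne (by positivity) fun h => ?_
    have := p.2.2
    have h1 : ‖p.1.1‖ = 0 := by linarith [norm_nonneg p.1.1]
    have h2 : ∑ v, p.1.2 v = 0 := by linarith [norm_nonneg p.1.1]
    rw [h1, h2] at this
    norm_num at this
  refine toModel_eq _ (contractionVec_mem z p 1) (contractionVec_ne_zero z p 1) hc (Prod.ext ?_ ?_)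
  · change p.1.1 + (((1 : I) : ℝ) * ∑ v, p.1.2 v) • EuclideanSpace.single z 1 =
      (‖p.1.1‖ + ∑ v, p.1.2 v) • EuclideanSpace.single z (1 : ℝ)
    rw [add_smul, ← hu, Set.Icc.coe_one, one_mul]
  · simp [contractionVec, modelPole, hz]

end

/-! ### The open orthant and the complement of a ray -/

section
variable {l : ℕ}

/-- A map from the open orthant of `ℝ^l` to the complement of the ray through `e_z`; both are
identified with `ℝ_{>0} × ℝ^{l-1}`, the orthant by the coordinate `a_z` and the logarithms of
`a_i / a_z`, the complement of the ray by `‖u‖ - u_z` and stereographic projection. The map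
commutes with multiplication by positive scalars. -/
def orthantToSlit (z : Fin l) (a : Fin l → ℝ) : EuclideanSpace ℝ (Fin l) :=
  WithLp.toLp 2 fun i => a z * (Real.log (a i / a z) +
    if i = z then (∑ j, Real.log (a j / a z) ^ 2 - 1) / 2 else 0)

/-- The inverse of `orthantToSlit z`. -/
def slitToOrthant (z : Fin l) (u : EuclideanSpace ℝ (Fin l)) (i : Fin l) : ℝ :=
  (‖u‖ - u z) * Real.exp ((if i = z then 0 else u i) / (‖u‖ - u z))

variable (z : Fin l)

theorem slitToOrthant_pos {u : EuclideanSpace ℝ (Fin l)} (hu : u z < ‖u‖) (i : Fin l) :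
    0 < slitToOrthant z u i :=
  mul_pos (sub_pos.2 hu) (Real.exp_pos _)

theorem slitToOrthant_self (u : EuclideanSpace ℝ (Fin l)) :
    slitToOrthant z u z = ‖u‖ - u z := by
  simp [slitToOrthant]

theorem orthantToSlit_smul (a : Fin l → ℝ) {c : ℝ} (hc : 0 < c) :
    orthantToSlit z (c • a) = c • orthantToSlit z a := by
  ext i
  simp [orthantToSlit, mul_div_mul_left _ _ hc.ne', mul_assoc]

theorem slitToOrthant_smul (u : EuclideanSpace ℝ (Fin l)) {c : ℝ} (hc : 0 < c) :
    slitToOrthant z (c • u) = c • slitToOrthant z u := by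
  ext i
  simp only [slitToOrthant, norm_smul, Real.norm_of_nonneg hc.le, PiLp.smul_apply, smul_eq_mul,
    Pi.smul_apply, ← mul_sub]
  have : (if i = z then 0 else c * u i) = c * (if i = z then 0 else u i) := by split_ifs <;> simp
  rw [this, mul_div_mul_left _ _ hc.ne', mul_assoc]

theorem orthantToSlit_self {a : Fin l → ℝ} (ha : ∀ i, 0 < a i) :
    orthantToSlit z a z = a z * ((∑ j, Real.log (a j / a z) ^ 2 - 1) / 2) := by
  simp [orthantToSlit, (ha z).ne']

theorem norm_orthantToSlit {a : Fin l → ℝ} (ha : ∀ i, 0 < a i) :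
    ‖orthantToSlit z a‖ = a z * ((∑ j, Real.log (a j / a z) ^ 2 + 1) / 2) := by
  have hz := ha z
  have h0 : 0 ≤ ∑ j, Real.log (a j / a z) ^ 2 := Finset.sum_nonneg fun j _ => sq_nonneg _
  rw [← sq_eq_sq₀ (norm_nonneg _) (by positivity), EuclideanSpace.real_norm_sq_eq]
  have h1 : ∀ i, (orthantToSlit z a i) ^ 2 = a z ^ 2 * (Real.log (a i / a z) ^ 2 +
      if i = z then ((∑ j, Real.log (a j / a z) ^ 2 - 1) / 2) ^ 2 else 0) := fun i => by
    rcases eq_or_ne i z with rfl | hi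
    · simp [orthantToSlit, hz.ne', mul_pow]
    · simp [orthantToSlit, hi, mul_pow]
  simp only [h1, ← Finset.mul_sum, Finset.sum_add_distrib, Finset.sum_ite_eq', Finset.mem_univ,
    if_true]
  ring

theorem orthantToSlit_lt {a : Fin l → ℝ} (ha : ∀ i, 0 < a i) :
    orthantToSlit z a z < ‖orthantToSlit z a‖ := by
  rw [orthantToSlit_self z ha, norm_orthantToSlit z ha]
  exact mul_lt_mul_of_pos_left (by linarith) (ha z)

theorem slitToOrthant_orthantToSlit {a : Fin l → ℝ} (ha : ∀ i, 0 < a i) :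
    slitToOrthant z (orthantToSlit z a) = a := by
  have h : ‖orthantToSlit z a‖ - orthantToSlit z a z = a z := by
    rw [orthantToSlit_self z ha, norm_orthantToSlit z ha]
    ring
  ext i
  rw [slitToOrthant, h]
  rcases eq_or_ne i z with rfl | hi
  · simp
  · have hz := (ha z).ne'
    simp only [orthantToSlit, hi, if_false, add_zero]
    rw [mul_div_cancel_left₀ _ hz, Real.exp_log (div_pos (ha i) (ha z)), mul_div_cancel₀ _ hz]

theorem orthantToSlit_slitToOrthant {u : EuclideanSpace ℝ (Fin l)} (hu : u z < ‖u‖) :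
    orthantToSlit z (slitToOrthant z u) = u := by
  have hρ : 0 < ‖u‖ - u z := sub_pos.2 hu
  have hlog : ∀ i, Real.log (slitToOrthant z u i / slitToOrthant z u z) =
      (if i = z then 0 else u i) / (‖u‖ - u z) := fun i => by
    rw [slitToOrthant_self, slitToOrthant, mul_div_cancel_left₀ _ hρ.ne', Real.log_exp]
  have hsum : ∑ j, ((if j = z then 0 else u j) / (‖u‖ - u z)) ^ 2 =
      (‖u‖ + u z) / (‖u‖ - u z) := by
    have h1 : ∑ j, (if j = z then 0 else u j) ^ 2 = ‖u‖ ^ 2 - u z ^ 2 := by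
      rw [EuclideanSpace.real_norm_sq_eq, ← Finset.add_sum_erase _ _ (Finset.mem_univ z),
        ← Finset.add_sum_erase Finset.univ (fun j => u j ^ 2) (Finset.mem_univ z)]
      simp only [if_true, ne_eq, OfNat.ofNat_ne_zero, not_false_eq_true, zero_pow, zero_add,
        add_sub_cancel_left]
      exact Finset.sum_congr rfl fun j hj => by rw [if_neg (Finset.ne_of_mem_erase hj)]
    simp only [div_pow, ← Finset.sum_div, h1]
    rw [div_eq_div_iff (by positivity) hρ.ne']
    ring
  ext i
  simp only [orthantToSlit, hlog, hsum]
  rw [slitToOrthant_self]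
  rcases eq_or_ne i z with rfl | hi
  · simp only [if_true, zero_div, zero_add]
    field_simp
    ring
  · simp only [hi, if_false, add_zero]
    exact mul_div_cancel₀ _ hρ.ne'

variable {X : Type} [TopologicalSpace X]

theorem continuous_orthantToSlit {a : X → Fin l → ℝ} (hc : Continuous a)
    (ha : ∀ x i, 0 < a x i) : Continuous fun x => orthantToSlit z (a x) := by
  have hlog : ∀ i, Continuous fun x => Real.log (a x i / a x z) := fun i =>
    Continuous.log (Continuous.div (by fun_prop) (by fun_prop) fun x => (ha x z).ne')
      fun x => (div_pos (ha x i) (ha x z)).ne'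
  refine (PiLp.continuous_toLp 2 _).comp (continuous_pi fun i => ?_)
  split_ifs <;> fun_prop

theorem continuous_slitToOrthant {u : X → EuclideanSpace ℝ (Fin l)} (hc : Continuous u)
    (hu : ∀ x, u x z < ‖u x‖) : Continuous fun x => slitToOrthant z (u x) := by
  refine continuous_pi fun i => ?_
  unfold slitToOrthant
  have h0 : ∀ x, ‖u x‖ - u x z ≠ 0 := fun x => (sub_pos.2 (hu x)).ne'
  split_ifs <;>
  exact Continuous.mul (by fun_prop) (Real.continuous_exp.comp
    (Continuous.div (by fun_prop) (by fun_prop) h0))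

end

/-! ### Open stars in a realization -/

section
variable {V W : Type} {l : ℕ}

/-- The injective map `κ` identifies `Fin l` with the vertices of a simplex of `K` and `W` with
other vertices in such a way that the faces of `K` containing the simplex correspond to the faces
of `L`, the empty one included. -/
structure IsStar (K : PreAbstractSimplicialComplex V) (L : PreAbstractSimplicialComplex W)
    (κ : Fin l ⊕ W → V) : Prop where
  injective : Function.Injective κ
  mem_faces_iff : ∀ S : Finset V, (S ∈ K.faces ∧ ∀ i, κ (Sum.inl i) ∈ S) ↔
    ∃ T : Finset W, (T = ∅ ∨ T ∈ L.faces) ∧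
      ∀ v, v ∈ S ↔ (∃ i, κ (Sum.inl i) = v) ∨ ∃ e ∈ T, κ (Sum.inr e) = v

variable {K : PreAbstractSimplicialComplex V} {L : PreAbstractSimplicialComplex W}
  {κ : Fin l ⊕ W → V}

/-- The vector of `ℝ^V` with coordinates `a` and `w` at the places given by `κ`, and `0`
elsewhere. -/
def joinVec (κ : Fin l ⊕ W → V) (a : Fin l → ℝ) (w : W → ℝ) : V → ℝ :=
  Function.extend κ (Sum.elim a w) 0

/-- The point of `ℝ^l × ℝ^W` with the same direction as the image of `x` in `joinModel l L`. -/
def starVec (κ : Fin l ⊕ W → V) (z : Fin l) (x : V → ℝ) :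
    EuclideanSpace ℝ (Fin l) × (W → ℝ) :=
  (orthantToSlit z fun i => x (κ (Sum.inl i)), fun e => x (κ (Sum.inr e)))

theorem joinVec_smul (κ : Fin l ⊕ W → V) (c : ℝ) (a : Fin l → ℝ) (w : W → ℝ) :
    joinVec κ (c • a) (c • w) = c • joinVec κ a w := by
  classical
  ext v
  simp only [joinVec, Function.extend_def, Pi.smul_apply, smul_eq_mul]
  split_ifs with h
  · generalize Classical.choose h = s
    cases s <;> rfl
  · simp

theorem Continuous.joinVec {X : Type} [TopologicalSpace X] {a : X → Fin l → ℝ} {w : X → W → ℝ}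
    (ha : Continuous a) (hw : Continuous w) : Continuous fun x => joinVec κ (a x) (w x) := by
  classical
  refine continuous_pi fun v => ?_
  simp only [_root_.joinVec, Function.extend_def]
  split_ifs with h
  · generalize Classical.choose h = s
    cases s with
    | inl i => exact (continuous_apply i).comp ha
    | inr e => exact (continuous_apply e).comp hw
  · exact continuous_const

theorem starVec_lt {z : Fin l} {x : V → ℝ} (hp : ∀ i, 0 < x (κ (Sum.inl i))) :
    (starVec κ z x).1 z < ‖(starVec κ z x).1‖ := orthantToSlit_lt z hp

theorem starVec_ne_zero {z : Fin l} {x : V → ℝ} (hp : ∀ i, 0 < x (κ (Sum.inl i))) :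
    starVec κ z x ≠ 0 := fun h => by
  have := starVec_lt (z := z) hp
  simp [h] at this

namespace IsStar

theorem joinVec_inl (h : IsStar K L κ) (a : Fin l → ℝ) (w : W → ℝ) (i : Fin l) :
    joinVec κ a w (κ (Sum.inl i)) = a i := h.injective.extend_apply _ _ _

theorem joinVec_inr (h : IsStar K L κ) (a : Fin l → ℝ) (w : W → ℝ) (e : W) :
    joinVec κ a w (κ (Sum.inr e)) = w e := h.injective.extend_apply _ _ _

theorem joinVec_of_notMem (a : Fin l → ℝ) (w : W → ℝ) {v : V} (hv : v ∉ Set.range κ) :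
    joinVec κ a w v = 0 := Function.extend_apply' _ _ _ hv

variable [Fintype V]

theorem exists_supp (h : IsStar K L κ) {x : V → ℝ} (hx : x ∈ realization K)
    (hp : ∀ i, 0 < x (κ (Sum.inl i))) :
    ∃ T : Finset W, (T = ∅ ∨ T ∈ L.faces) ∧
      ∀ v, v ∈ supp x ↔ (∃ i, κ (Sum.inl i) = v) ∨ ∃ e ∈ T, κ (Sum.inr e) = v :=
  (h.mem_faces_iff _).1 ⟨(mem_realization.1 hx).2, fun i => mem_supp.2 (hp i).ne'⟩

variable [Fintype W]

theorem sum_joinVec (h : IsStar K L κ) (a : Fin l → ℝ) (w : W → ℝ) :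
    ∑ v, joinVec κ a w v = ∑ i, a i + ∑ e, w e := by
  rw [← Fintype.sum_of_injective κ h.injective (Sum.elim a w) (joinVec κ a w)
    (fun v hv => joinVec_of_notMem a w hv) fun v => (h.injective.extend_apply _ _ _).symm]
  simp

theorem joinVec_mem (h : IsStar K L κ) {a : Fin l → ℝ} {w : W → ℝ} (ha : ∀ i, 0 < a i)
    (hw : w ∈ coneSet L) (h1 : ∑ i, a i + ∑ e, w e = 1) : joinVec κ a w ∈ realization K := by
  refine mem_realization.2 ⟨⟨fun v => ?_, (h.sum_joinVec a w).trans h1⟩,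
    ((h.mem_faces_iff _).2 ⟨supp w, hw.2.imp_left supp_eq_empty.2, fun v => ?_⟩).1⟩
  · by_cases hv : v ∈ Set.range κ
    · obtain ⟨i | e, rfl⟩ := hv
      · rw [h.joinVec_inl]; exact (ha i).le
      · rw [h.joinVec_inr]; exact hw.1 e
    · rw [joinVec_of_notMem a w hv]
  · rw [mem_supp]
    constructor
    · intro hv
      by_cases hr : v ∈ Set.range κ
      · obtain ⟨i | e, rfl⟩ := hr
        · exact Or.inl ⟨i, rfl⟩
        · rw [h.joinVec_inr] at hv
          exact Or.inr ⟨e, mem_supp.2 hv, rfl⟩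
      · exact absurd (joinVec_of_notMem a w hr) hv
    · rintro (⟨i, rfl⟩ | ⟨e, he, rfl⟩)
      · rw [h.joinVec_inl]; exact (ha i).ne'
      · rw [h.joinVec_inr]; exact mem_supp.1 he

theorem comp_inr_mem (h : IsStar K L κ) {x : V → ℝ} (hx : x ∈ realization K)
    (hp : ∀ i, 0 < x (κ (Sum.inl i))) : (fun e => x (κ (Sum.inr e))) ∈ coneSet L := by
  obtain ⟨T, hT, hs⟩ := h.exists_supp hx hp
  have : supp (fun e => x (κ (Sum.inr e))) = T := by
    ext e
    rw [mem_supp, ← mem_supp (x := x), hs]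
    simp [h.injective.eq_iff]
  exact ⟨fun e => hx.1.1 _, by rwa [← supp_eq_empty, this]⟩

theorem joinVec_comp (h : IsStar K L κ) {x : V → ℝ} (hx : x ∈ realization K)
    (hp : ∀ i, 0 < x (κ (Sum.inl i))) :
    joinVec κ (fun i => x (κ (Sum.inl i))) (fun e => x (κ (Sum.inr e))) = x := by
  obtain ⟨T, hT, hs⟩ := h.exists_supp hx hp
  ext v
  by_cases hv : v ∈ Set.range κ
  · obtain ⟨i | e, rfl⟩ := hv
    exacts [h.joinVec_inl _ _ i, h.joinVec_inr _ _ e]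
  · rw [joinVec_of_notMem _ _ hv]
    by_contra h0
    rcases (hs v).1 (mem_supp.2 (Ne.symm h0)) with ⟨i, rfl⟩ | ⟨e, -, rfl⟩
    exacts [hv ⟨_, rfl⟩, hv ⟨_, rfl⟩]

theorem notMem_poleCone {z : Fin l} {p : joinModel l L} :
    p ∉ poleCone l L z ↔ p.1.1 z < ‖p.1.1‖ := by
  rw [← not_le]; rfl

theorem weight_pos {z : Fin l} {p : joinModel l L} (hp : p ∉ poleCone l L z) :
    0 < ∑ i, slitToOrthant z p.1.1 i + ∑ e, p.1.2 e :=
  add_pos_of_pos_of_nonneg (Finset.sum_pos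
    (fun i _ => slitToOrthant_pos z (notMem_poleCone.1 hp) i) ⟨z, Finset.mem_univ z⟩)
    (sum_nonneg_of_mem_coneSet p.2.1)

/-- The image in `|K|` of a point of the join of `S^{l-1}` and `|L|` outside `e_z ∗ |L|`. -/
def starPoint (h : IsStar K L κ) (z : Fin l) (p : joinModel l L) (hp : p ∉ poleCone l L z) :
    realization K :=
  ⟨(∑ i, slitToOrthant z p.1.1 i + ∑ e, p.1.2 e)⁻¹ •
      joinVec κ (slitToOrthant z p.1.1) p.1.2, by
    have hN := weight_pos hp
    rw [← joinVec_smul]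
    refine h.joinVec_mem
      (fun i => mul_pos (inv_pos.2 hN) (slitToOrthant_pos z (notMem_poleCone.1 hp) i))
      (smul_mem_coneSet p.2.1 (inv_pos.2 hN).le) ?_
    simp only [Pi.smul_apply, smul_eq_mul, ← Finset.mul_sum]
    rw [← mul_add, inv_mul_cancel₀ hN.ne']⟩

theorem starPoint_pos (h : IsStar K L κ) {z : Fin l} {p : joinModel l L}
    (hp : p ∉ poleCone l L z) (i : Fin l) : 0 < (h.starPoint z p hp).1 (κ (Sum.inl i)) := by
  simp only [starPoint, Pi.smul_apply, h.joinVec_inl]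
  exact mul_pos (inv_pos.2 (weight_pos hp)) (slitToOrthant_pos z (notMem_poleCone.1 hp) i)

/-- The open star of the simplex `κ (Fin l)` in `|K|` is homeomorphic to the join of `S^{l-1}` and
`|L|` without the cone `e_z ∗ |L|`. -/
def homeo (h : IsStar K L κ) (z : Fin l) :
    {p : joinModel l L // p ∉ poleCone l L z} ≃ₜ
      {x : realization K // ∀ i, 0 < x.1 (κ (Sum.inl i))} where
  toFun p := ⟨h.starPoint z p.1 p.2, h.starPoint_pos p.2⟩
  invFun x :=
    ⟨toModel (starVec κ z x.1.1) (h.comp_inr_mem x.1.2 x.2) (starVec_ne_zero x.2), by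
      rw [notMem_poleCone]
      have hN := inv_pos.2 (modelNorm_pos (h.comp_inr_mem x.1.2 x.2) (starVec_ne_zero (z := z) x.2))
      change ((modelNorm (starVec κ z x.1.1))⁻¹ • (starVec κ z x.1.1).1 :
        EuclideanSpace ℝ (Fin l)) z < ‖(modelNorm (starVec κ z x.1.1))⁻¹ • (starVec κ z x.1.1).1‖
      rw [norm_smul, Real.norm_of_nonneg hN.le]
      exact mul_lt_mul_of_pos_left (starVec_lt x.2) hN⟩
  left_inv p := by
    have hN := inv_pos.2 (weight_pos p.2)
    refine Subtype.ext (toModel_eq p.1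
      (h.comp_inr_mem (h.starPoint z p.1 p.2).2 (h.starPoint_pos p.2))
      (starVec_ne_zero (h.starPoint_pos p.2)) hN (Prod.ext ?_ ?_))
    · simp only [starVec, starPoint, Pi.smul_apply, h.joinVec_inl]
      exact (orthantToSlit_smul z _ hN).trans
        (by rw [orthantToSlit_slitToOrthant z (notMem_poleCone.1 p.2)]; rfl)
    · ext e
      simp [starVec, starPoint, h.joinVec_inr]
  right_inv x := by
    refine Subtype.ext (Subtype.ext ?_)
    have hN := inv_pos.2 (modelNorm_pos (h.comp_inr_mem x.1.2 x.2) (starVec_ne_zero (z := z) x.2))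
    change (∑ i, slitToOrthant z ((modelNorm (starVec κ z x.1.1))⁻¹ • (starVec κ z x.1.1).1) i +
        ∑ e, ((modelNorm (starVec κ z x.1.1))⁻¹ • (starVec κ z x.1.1).2) e)⁻¹ •
      joinVec κ (slitToOrthant z ((modelNorm (starVec κ z x.1.1))⁻¹ • (starVec κ z x.1.1).1))
        ((modelNorm (starVec κ z x.1.1))⁻¹ • (starVec κ z x.1.1).2) = x.1.1
    have hx : joinVec κ (slitToOrthant z (starVec κ z x.1.1).1) (starVec κ z x.1.1).2 = x.1.1 := by
      simp only [starVec, slitToOrthant_orthantToSlit z x.2]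
      exact h.joinVec_comp x.1.2 x.2
    rw [slitToOrthant_smul z _ hN, ← h.sum_joinVec, joinVec_smul, hx]
    simp only [Pi.smul_apply, smul_eq_mul, ← Finset.mul_sum, x.1.2.1.2, mul_one]
    rw [smul_smul, inv_mul_cancel₀ hN.ne', one_smul]
  continuous_toFun := by
    have hψ : Continuous fun p : {p : joinModel l L // p ∉ poleCone l L z} =>
        slitToOrthant z p.1.1.1 :=
      continuous_slitToOrthant z (by fun_prop) fun p => notMem_poleCone.1 p.2
    refine Continuous.subtype_mk (Continuous.subtype_mk (Continuous.smul (Continuous.inv₀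
      (by fun_prop) fun p => (weight_pos p.2).ne') (hψ.joinVec (by fun_prop))) _) _
  continuous_invFun := by
    have hq : Continuous fun x : {x : realization K // ∀ i, 0 < x.1 (κ (Sum.inl i))} =>
        starVec κ z x.1.1 :=
      Continuous.prodMk (continuous_orthantToSlit z (continuous_pi fun i =>
        (continuous_apply _).comp (continuous_subtype_val.comp continuous_subtype_val))
        fun x => x.2) (continuous_pi fun e =>
        (continuous_apply _).comp (continuous_subtype_val.comp continuous_subtype_val))
    exact Continuous.subtype_mk (Continuous.subtype_mk (Continuous.smul (Continuous.inv₀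
      (continuous_modelNorm.comp hq) fun x =>
        (modelNorm_pos (h.comp_inr_mem x.1.2 x.2) (starVec_ne_zero x.2)).ne') hq) _) _

end IsStar
end

/-! ### Quotients of complexes as wedges of joins -/

section
variable {V ι : Type} [Fintype V] {W : ι → Type} [∀ i, Fintype (W i)] {l : ι → ℕ}

/-- A wedge of joins is homotopy equivalent to its quotient by the cones `e_z ∗ |L_i|`. -/
theorem nonempty_wedge_homotopyEquiv (L : ∀ i, PreAbstractSimplicialComplex (W i))
    (z : ∀ i, Fin (l i)) :
    Nonempty (Wedge (fun i => joinModel (l i) (L i)) (fun i => modelPole (L i) (z i)) ≃ₕ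
      Collapse {p : Σ i, joinModel (l i) (L i) | p.2 ∈ poleCone (l p.1) (L p.1) (z p.1)}) := by
  let H : C(Σ i, joinModel (l i) (L i), C(I, Σ i, joinModel (l i) (L i))) :=
    ⟨fun p => (ContinuousMap.sigmaMk p.1).comp (contraction (L p.1) (z p.1) p.2),
      continuous_sigma fun i => (ContinuousMap.continuous_postcomp (ContinuousMap.sigmaMk i)).comp
        (contraction (L i) (z i)).continuous⟩
  refine Collapse.nonempty_homotopyEquiv ?_ H ?_ ?_ ?_ ?_
  · rintro _ ⟨i, rfl⟩
    exact modelPole_mem_poleCone _ _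
  · rintro ⟨i, p⟩
    exact congrArg (Sigma.mk i) (contraction_zero (L i) (z i) p)
  · rintro ⟨i, p⟩ hp t
    exact contraction_mem (L i) (z i) hp t
  · rintro _ ⟨i, rfl⟩ t
    exact ⟨i, congrArg (Sigma.mk i) (contraction_modelPole (L i) (z i) t).symm⟩
  · rintro ⟨i, p⟩ hp
    exact ⟨i, congrArg (Sigma.mk i) (contraction_one (L i) (z i) hp).symm⟩

theorem isClosed_poleCone {n : ℕ} {U : Type} [Fintype U] (K : PreAbstractSimplicialComplex U)
    (z : Fin n) : IsClosed (poleCone n K z) :=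
  isClosed_le (by fun_prop) (by fun_prop)

variable {K K' : PreAbstractSimplicialComplex V} {L : ∀ i, PreAbstractSimplicialComplex (W i)}
  {κ : ∀ i, Fin (l i) ⊕ W i → V}

/-- The open stars of simplices of `K`, no two of which lie in a common face, are disjoint open
subsets of `|K|`. -/
theorem IsStar.isOpenEmbedding (h : ∀ i, IsStar K (L i) (κ i)) (z : ∀ i, Fin (l i))
    (huniq : ∀ S ∈ K.faces, ∀ i k, (∀ j, κ i (Sum.inl j) ∈ S) → (∀ j, κ k (Sum.inl j) ∈ S) →
      i = k) :
    IsOpenEmbedding fun p : Σ i, {p : joinModel (l i) (L i) // p ∉ poleCone (l i) (L i) (z i)} =>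
      ((h p.1).homeo (z p.1) p.2).1 := by
  refine .of_continuous_injective_isOpenMap ?_ ?_ ?_
  · exact continuous_sigma fun i => continuous_subtype_val.comp ((h i).homeo (z i)).continuous
  · rintro ⟨i, p⟩ ⟨k, q⟩ hpq
    have hpos := ((h i).homeo (z i) p).2
    have hpos' := ((h k).homeo (z k) q).2
    obtain rfl : i = k := by
      refine huniq _ (mem_realization.1 ((h i).homeo (z i) p).1.2).2 i k
        (fun j => mem_supp.2 (hpos j).ne') fun j => mem_supp.2 ?_
      change (h i).homeo (z i) p = ((h k).homeo (z k) q).1 at hpq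
      rw [hpq]
      exact (hpos' j).ne'
    exact congrArg (Sigma.mk i) (((h i).homeo (z i)).injective (Subtype.ext hpq))
  · refine isOpenMap_sigma.2 fun i => ?_
    have : IsOpen {x : realization K | ∀ j, 0 < x.1 (κ i (Sum.inl j))} := by
      rw [Set.ofPred_forall]
      exact isOpen_iInter_of_finite fun j => isOpen_lt continuous_const
        ((continuous_apply _).comp continuous_subtype_val)
    exact this.isOpenMap_subtype_val.comp ((h i).homeo (z i)).isOpenMap

/-- Let `K'` be the subcomplex of `K` that consists of the faces containing none of the given
simplices `σ_i`, no two of which lie in a common face. If the star of `σ_i` is the join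
`σ_i ∗ L_i`, then `|K| / |K'|` is homotopy equivalent to the wedge of the joins
`S^{dim σ_i} ∗ |L_i|`. -/
theorem nonempty_quotientSpace_homotopyEquiv [Finite ι] (h : ∀ i, IsStar K (L i) (κ i))
    (hK' : ∀ S ∈ K.faces, S ∈ K'.faces ↔ ∀ i, ¬ ∀ j, κ i (Sum.inl j) ∈ S)
    (huniq : ∀ S ∈ K.faces, ∀ i k, (∀ j, κ i (Sum.inl j) ∈ S) → (∀ j, κ k (Sum.inl j) ∈ S) →
      i = k) (hl : ∀ i, 0 < l i) :
    Nonempty (QuotientSpace K K' ≃ₕ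
      Wedge (fun i => Join (unitSphere (l i)) (realization (L i)))
        fun i => Join.inl (spherePoint _ (hl i))) := by
  let z : ∀ i, Fin (l i) := fun i => ⟨0, hl i⟩
  -- both quotients are one-point compactifications of the disjoint union of the open stars
  obtain ⟨e1⟩ : Nonempty (QuotientSpace K K' ≃ₜ OnePoint _) := by
    refine Collapse.nonempty_homeomorph_onePoint (IsStar.isOpenEmbedding h z huniq) ?_
    ext x
    have hx := mem_realization.1 x.2
    have hx' : (x : V → ℝ) ∈ realization K' ↔ supp x.1 ∈ K'.faces :=
      mem_realization.trans (and_iff_right hx.1)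
    rw [Set.mem_compl_iff, Set.mem_ofPred_eq, hx', hK' _ hx.2]
    push Not
    constructor
    · rintro ⟨⟨i, p⟩, rfl⟩
      exact ⟨i, fun j => mem_supp.2 (((h i).homeo (z i) p).2 j).ne'⟩
    · rintro ⟨i, hi⟩
      refine ⟨⟨i, ((h i).homeo (z i)).symm
        ⟨x, fun j => lt_of_le_of_ne (x.2.1.1 _) (mem_supp.1 (hi j)).symm⟩⟩, ?_⟩
      simp
  obtain ⟨e2⟩ := Collapse.nonempty_homeomorph_onePoint
    (A := {p : Σ i, joinModel (l i) (L i) | p.2 ∈ poleCone (l p.1) (L p.1) (z p.1)})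
    (Z := Σ i, {p : joinModel (l i) (L i) // p ∉ poleCone (l i) (L i) (z i)})
    (e := Sigma.map id fun _ => Subtype.val)
    (isOpenEmbedding_sigmaMap Function.injective_id |>.2 fun i =>
      (isClosed_poleCone (L i) (z i)).isOpen_compl.isOpenEmbedding_subtypeVal) (by
        ext ⟨i, p⟩
        constructor
        · rintro ⟨⟨k, q⟩, hq⟩
          rw [← hq]
          exact q.2
        · exact fun hp => ⟨⟨i, p, hp⟩, rfl⟩)
  obtain ⟨e3⟩ := nonempty_wedge_homotopyEquiv L z
  have e4 : Wedge (fun i => Join (unitSphere (l i)) (realization (L i)))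
      (fun i => Join.inl (spherePoint _ (hl i))) ≃ₜ
      Wedge (fun i => joinModel (l i) (L i)) (fun i => modelPole (L i) (z i)) :=
    wedgeCongr (fun i => joinHomeo (l i) (L i)) fun i => Subtype.ext (joinHomeo_inl _)
  exact ⟨(e1.trans e2.symm).toHomotopyEquiv.trans (e3.symm.trans e4.symm.toHomotopyEquiv)⟩

end

/-! ### Cycles in rook configurations -/

namespace IsRookConfig

variable {n : ℕ} {S T : DiGraph n}

theorem mono (hT : IsRookConfig T) (h : S ⊆ T) : IsRookConfig S :=
  fun e he f hf => hT e (h he) f (h hf)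

theorem eq_of_fst (hS : IsRookConfig S) {e f : Fin n × Fin n} (he : e ∈ S) (hf : f ∈ S)
    (h : e.1 = f.1) : e = f := by
  by_contra hne
  exact (hS e he f hf hne).1 h

theorem eq_of_snd (hS : IsRookConfig S) {e f : Fin n × Fin n} (he : e ∈ S) (hf : f ∈ S)
    (h : e.2 = f.2) : e = f := by
  by_contra hne
  exact (hS e he f hf hne).2 h

end IsRookConfig

namespace DiGraph

variable {n : ℕ} {S T C D : DiGraph n}

/-- The vertices that are tails of edges. For a disjoint union of cycles, these are all the
vertices met by the edges. -/
def tails (C : DiGraph n) : Finset (Fin n) := C.image Prod.fst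

theorem fst_mem_tails {e : Fin n × Fin n} (he : e ∈ C) : e.1 ∈ C.tails :=
  Finset.mem_image_of_mem _ he

theorem IsCycle.isRookConfig (hD : IsCycle D) : IsRookConfig D := by
  obtain ⟨k, x, hx, rfl⟩ := hD
  intro e he f hf hef
  obtain ⟨i, -, rfl⟩ := Finset.mem_image.1 he
  obtain ⟨j, -, rfl⟩ := Finset.mem_image.1 hf
  have hij : i ≠ j := fun h => hef (by rw [h])
  exact ⟨fun h => hij (hx h), fun h => hij (add_right_cancel (hx h))⟩

theorem IsCycle.nonempty (hD : IsCycle D) : D.Nonempty := by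
  obtain ⟨k, x, -, rfl⟩ := hD
  exact Finset.univ_nonempty.image _

theorem IsCycle.exists_mem_fst (hD : IsCycle D) {e : Fin n × Fin n} (he : e ∈ D) :
    ∃ f ∈ D, f.1 = e.2 := by
  obtain ⟨k, x, -, rfl⟩ := hD
  obtain ⟨i, -, rfl⟩ := Finset.mem_image.1 he
  exact ⟨_, Finset.mem_image_of_mem _ (Finset.mem_univ (i + 1)), rfl⟩

theorem IsCycle.exists_mem_snd (hD : IsCycle D) {e : Fin n × Fin n} (he : e ∈ D) :
    ∃ f ∈ D, f.2 = e.1 := by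
  obtain ⟨k, x, -, rfl⟩ := hD
  obtain ⟨i, -, rfl⟩ := Finset.mem_image.1 he
  exact ⟨_, Finset.mem_image_of_mem _ (Finset.mem_univ (i - 1)), by simp⟩

theorem conn_of_mem {e : Fin n × Fin n} (he : e ∈ S) : S.Conn e.1 e.2 :=
  Relation.EqvGen.rel _ _ he

theorem IsCycle.conn (hD : IsCycle D) {e f : Fin n × Fin n} (he : e ∈ D) (hf : f ∈ D) :
    D.Conn e.1 f.1 := by
  obtain ⟨k, x, -, hDx⟩ := hD
  have key : ∀ i, D.Conn (x 0) (x i) := fun i => by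
    induction i using Fin.induction with
    | zero => exact Relation.EqvGen.refl _
    | succ i ih =>
      refine Relation.EqvGen.trans _ _ _ ih (Relation.EqvGen.rel _ _ ?_)
      rw [hDx, ← Fin.coeSucc_eq_succ]
      exact Finset.mem_image_of_mem (fun i => (x i, x (i + 1))) (Finset.mem_univ _)
  rw [hDx] at he hf
  obtain ⟨i, -, rfl⟩ := Finset.mem_image.1 he
  obtain ⟨j, -, rfl⟩ := Finset.mem_image.1 hf
  exact Relation.EqvGen.trans _ _ _ (Relation.EqvGen.symm _ _ (key i)) (key j)

theorem mem_component {v : Fin n} {e : Fin n × Fin n} :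
    e ∈ S.component v ↔ e ∈ S ∧ S.Conn v e.1 := by
  simp [component]

theorem self_mem_component {e : Fin n × Fin n} (he : e ∈ S) : e ∈ S.component e.1 :=
  mem_component.2 ⟨he, Relation.EqvGen.refl _⟩

theorem component_mem_components {e : Fin n × Fin n} (he : e ∈ S) :
    S.component e.1 ∈ S.components := Finset.mem_image_of_mem _ he

theorem component_subset (v : Fin n) : S.component v ⊆ S := fun _ he => (mem_component.1 he).1

theorem subset_of_mem_components (hD : D ∈ S.components) : D ⊆ S := by
  obtain ⟨e, -, rfl⟩ := Finset.mem_image.1 hD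
  exact component_subset _

theorem component_eq_of_mem {v : Fin n} {e : Fin n × Fin n} (he : e ∈ S.component v) :
    S.component e.1 = S.component v := by
  have h := (mem_component.1 he).2
  ext f
  rw [mem_component, mem_component]
  exact and_congr_right fun _ => ⟨fun hf => h.trans _ _ _ hf,
    fun hf => (h.symm).trans _ _ _ hf⟩

theorem component_eq_of_mem_components (hD : D ∈ S.components) {e : Fin n × Fin n} (he : e ∈ D) :
    S.component e.1 = D := by
  obtain ⟨f, -, rfl⟩ := Finset.mem_image.1 hD
  exact component_eq_of_mem he

/-- In a rook configuration, an edge that meets a cycle belongs to the cycle; so the cycle is a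
connected component. -/
theorem IsCycle.component_eq (hD : IsCycle D) (hS : IsRookConfig S) (h : D ⊆ S)
    {e : Fin n × Fin n} (he : e ∈ D) : S.component e.1 = D := by
  have hclosed : ∀ a b, S.Conn a b → ((∃ f ∈ D, f.1 = a) ↔ ∃ f ∈ D, f.1 = b) := by
    intro a b hab
    induction hab with
    | rel a b hab =>
      constructor
      · rintro ⟨f, hf, rfl⟩
        have : f = (f.1, b) := hS.eq_of_fst (h hf) hab rfl
        obtain ⟨g, hg, hg'⟩ := hD.exists_mem_fst hf
        exact ⟨g, hg, hg'.trans (congrArg Prod.snd this)⟩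
      · rintro ⟨f, hf, rfl⟩
        obtain ⟨g, hg, hg'⟩ := hD.exists_mem_snd hf
        exact ⟨g, hg, congrArg Prod.fst (hS.eq_of_snd (h hg) hab hg')⟩
    | refl => rfl
    | symm _ _ _ ih => exact ih.symm
    | trans _ _ _ _ _ ih1 ih2 => exact ih1.trans ih2
  ext f
  rw [mem_component]
  constructor
  · rintro ⟨hf, hc⟩
    obtain ⟨g, hg, hgf⟩ := (hclosed _ _ hc).1 ⟨e, he, rfl⟩
    rwa [← hS.eq_of_fst (h hg) hf hgf]
  · exact fun hf => ⟨h hf, Relation.EqvGen.mono (fun _ _ hab => h hab) _ _ (hD.conn he hf)⟩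

open Classical in
/-- The cycles among the components of a graph. For a rook configuration, these are all the cycles
contained in it. -/
def cycles (S : DiGraph n) : Finset (DiGraph n) := S.components.filter IsCycle

theorem mem_cycles_iff_components : D ∈ S.cycles ↔ D ∈ S.components ∧ IsCycle D := by
  simp [cycles]

theorem numCycles_eq (S : DiGraph n) : S.numCycles = S.cycles.card := rfl

theorem mem_cycles (hS : IsRookConfig S) : D ∈ S.cycles ↔ D ⊆ S ∧ IsCycle D := by
  rw [mem_cycles_iff_components]
  refine and_congr_left fun hD => ⟨subset_of_mem_components, fun h => ?_⟩
  obtain ⟨e, he⟩ := hD.nonempty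
  rw [← hD.component_eq hS h he]
  exact component_mem_components (h he)

theorem numCycles_eq_zero (hS : IsRookConfig S) :
    S.numCycles = 0 ↔ ∀ D, D ⊆ S → ¬ IsCycle D := by
  rw [numCycles_eq, Finset.card_eq_zero, Finset.eq_empty_iff_forall_notMem]
  simp only [mem_cycles hS, not_and]

/-! ### Multicycles -/

section
variable {p : ℕ}

theorem IsMulticycle.cycles_eq (hC : IsMulticycle p C) : C.cycles = C.components := by
  ext D
  exact mem_cycles_iff_components.trans (and_iff_left_of_imp (hC.2 D))

theorem IsMulticycle.numCycles_eq (hC : IsMulticycle p C) : C.numCycles = p := by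
  rw [DiGraph.numCycles_eq, hC.cycles_eq, hC.1]

theorem IsMulticycle.isCycle_component (hC : IsMulticycle p C) {e : Fin n × Fin n} (he : e ∈ C) :
    IsCycle (C.component e.1) := hC.2 _ (component_mem_components he)

theorem IsMulticycle.isRookConfig (hC : IsMulticycle p C) : IsRookConfig C := by
  intro e he f hf hef
  have hD := (hC.isCycle_component he).isRookConfig
  have hfe : C.Conn e.1 f.1 → f ∈ C.component e.1 := fun h => mem_component.2 ⟨hf, h⟩
  refine ⟨fun h => hef (hD.eq_of_fst (self_mem_component he) (hfe ?_) h),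
    fun h => hef (hD.eq_of_snd (self_mem_component he) (hfe ?_) h)⟩
  · rw [h]; exact Relation.EqvGen.refl _
  · exact (conn_of_mem he).trans _ _ _ (h ▸ (conn_of_mem hf).symm)

theorem IsMulticycle.nonempty (hC : IsMulticycle p C) (hp : 1 ≤ p) : C.Nonempty := by
  rw [Finset.nonempty_iff_ne_empty]
  rintro rfl
  have := hC.1
  simp [components] at this
  omega

theorem IsMulticycle.snd_mem_tails (hC : IsMulticycle p C) {e : Fin n × Fin n} (he : e ∈ C) :
    e.2 ∈ C.tails := by
  obtain ⟨f, hf, h⟩ := (hC.isCycle_component he).exists_mem_fst (self_mem_component he)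
  rw [← h]
  exact fst_mem_tails (component_subset _ hf)

theorem IsMulticycle.exists_snd (hC : IsMulticycle p C) {v : Fin n} (hv : v ∈ C.tails) :
    ∃ e ∈ C, e.2 = v := by
  obtain ⟨e, he, rfl⟩ := Finset.mem_image.1 hv
  obtain ⟨f, hf, h⟩ := (hC.isCycle_component he).exists_mem_snd (self_mem_component he)
  exact ⟨f, component_subset _ hf, h⟩

theorem card_eq_length (C : DiGraph n) : C.card = C.length := by
  have h : C = C.components.biUnion id := by
    ext e
    simp only [Finset.mem_biUnion, id]
    exact ⟨fun he => ⟨_, component_mem_components he, self_mem_component he⟩,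
      fun ⟨D, hD, he⟩ => subset_of_mem_components hD he⟩
  conv_lhs => rw [h]
  rw [Finset.card_biUnion]
  · rfl
  · intro D hD D' hD' hne
    refine Finset.disjoint_left.2 fun e he he' => ?_
    exact hne ((component_eq_of_mem_components hD he).symm.trans
      (component_eq_of_mem_components hD' he'))

theorem IsMulticycle.card_tails (hC : IsMulticycle p C) : C.tails.card = C.length := by
  rw [← card_eq_length, tails, Finset.card_image_of_injOn]
  exact fun e he f hf h => hC.isRookConfig.eq_of_fst he hf h

/-- In a rook configuration, an edge that meets a multicycle belongs to it. -/
theorem IsMulticycle.mem_of_mem_tails (hC : IsMulticycle p C) (hS : IsRookConfig S) (h : C ⊆ S)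
    {e : Fin n × Fin n} (he : e ∈ S) (ht : e.1 ∈ C.tails ∨ e.2 ∈ C.tails) : e ∈ C := by
  rcases ht with ht | ht
  · obtain ⟨f, hf, hfe⟩ := Finset.mem_image.1 ht
    rwa [← hS.eq_of_fst (h hf) he hfe]
  · obtain ⟨f, hf, hfe⟩ := hC.exists_snd ht
    rwa [← hS.eq_of_snd (h hf) he hfe]

/-- The union of the cycles of a graph. -/
def core (S : DiGraph n) : DiGraph n := S.cycles.biUnion id

theorem core_subset (S : DiGraph n) : S.core ⊆ S :=
  Finset.biUnion_subset.2 fun _ hD => subset_of_mem_components (mem_cycles_iff_components.1 hD).1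

theorem isMulticycle_core (hS : IsRookConfig S) : IsMulticycle S.numCycles S.core := by
  have hsub : ∀ D ∈ S.cycles, D ⊆ S.core := fun D hD => Finset.subset_biUnion_of_mem id hD
  have hcomp : S.core.components = S.cycles := by
    ext D
    constructor
    · intro hD
      obtain ⟨e, he, rfl⟩ := Finset.mem_image.1 hD
      obtain ⟨D, hD, heD⟩ := Finset.mem_biUnion.1 he
      rwa [((mem_cycles hS).1 hD).2.component_eq (hS.mono (core_subset S)) (hsub D hD) heD]
    · intro hD
      exact (mem_cycles_iff_components.1 ((mem_cycles (hS.mono (core_subset S))).2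
        ⟨hsub D hD, ((mem_cycles hS).1 hD).2⟩)).1
  exact ⟨by rw [hcomp, numCycles_eq], fun D hD => ((mem_cycles hS).1 (hcomp ▸ hD)).2⟩

/-- A rook configuration with at most `p` cycles contains at most one `p`-multicycle, the union of
its cycles. -/
theorem IsMulticycle.cycles_eq_of_subset (hC : IsMulticycle p C) (hS : IsRookConfig S)
    (h : C ⊆ S) (hp : S.numCycles ≤ p) : S.cycles = C.components := by
  refine (Finset.eq_of_subset_of_card_le (fun D hD => ?_) (hp.trans_eq hC.1.symm)).symm
  exact (mem_cycles hS).2 ⟨(subset_of_mem_components hD).trans h, hC.2 D hD⟩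

theorem IsMulticycle.eq_core (hC : IsMulticycle p C) (hS : IsRookConfig S)
    (h : C ⊆ S) (hp : S.numCycles ≤ p) : C = S.core := by
  rw [core, hC.cycles_eq_of_subset hS h hp]
  ext e
  simp only [Finset.mem_biUnion, id]
  exact ⟨fun he => ⟨_, component_mem_components he, self_mem_component he⟩,
    fun ⟨D, hD, he⟩ => subset_of_mem_components hD he⟩

theorem IsMulticycle.le_numCycles (hC : IsMulticycle p C) (hS : IsRookConfig S) (h : C ⊆ S) :
    p ≤ S.numCycles := hC.numCycles_eq ▸ numCycles_mono hS h

/-- A cycle is not a loop if and only if it has length at least two. -/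
theorem IsCycle.two_le_card_iff (hD : IsCycle D) : 2 ≤ D.card ↔ ∀ e ∈ D, e.1 ≠ e.2 := by
  obtain ⟨k, x, hx, rfl⟩ := hD
  have hcard : (Finset.univ.image fun i => (x i, x (i + 1))).card = k + 1 := by
    rw [Finset.card_image_of_injective _ fun i j h => hx (congrArg Prod.fst h)]
    simp
  rw [hcard]
  constructor
  · intro hk e he
    obtain ⟨i, -, rfl⟩ := Finset.mem_image.1 he
    intro h
    obtain rfl : k = 0 := by simpa using hx h
    omega
  · intro h
    by_contra hk
    obtain rfl : k = 0 := by omega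
    exact h _ (Finset.mem_image_of_mem _ (Finset.mem_univ 0)) rfl

theorem IsMulticycle.two_le_cycleType_iff (hC : IsMulticycle p C) :
    (∀ l ∈ C.cycleType, 2 ≤ l) ↔ ∀ e ∈ C, e.1 ≠ e.2 := by
  have h1 : (∀ l ∈ C.cycleType, 2 ≤ l) ↔ ∀ D ∈ C.components, 2 ≤ D.card := by
    simp [cycleType]
  rw [h1]
  constructor
  · exact fun h e he => (hC.isCycle_component he).two_le_card_iff.1
      (h _ (component_mem_components he)) e (self_mem_component he)
  · exact fun h D hD => (hC.2 D hD).two_le_card_iff.2 fun e he =>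
      h e (subset_of_mem_components hD he)

end

/-! ### Cycle-free configurations -/

/-- `PathFrom T r d v`: the vertex `r` is not the head of an edge of `T`, and `v` is reached from
`r` by a directed path of `d` edges of `T`. -/
def PathFrom (T : DiGraph n) (r : Fin n) : ℕ → Fin n → Prop
  | 0, v => v = r ∧ ∀ a, (a, v) ∉ T
  | d + 1, v => ∃ u, PathFrom T r d u ∧ (u, v) ∈ T

theorem PathFrom.unique (hT : IsRookConfig T) {r r' : Fin n} :
    ∀ {d d' : ℕ} {v : Fin n}, PathFrom T r d v → PathFrom T r' d' v → r = r' ∧ d = d'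
  | 0, 0, _, h, h' => ⟨h.1.symm.trans h'.1, rfl⟩
  | 0, _ + 1, _, h, ⟨u, _, hu⟩ => (h.2 u hu).elim
  | _ + 1, 0, _, ⟨u, _, hu⟩, h' => (h'.2 u hu).elim
  | d + 1, d' + 1, v, ⟨u, h, hu⟩, ⟨u', h', hu'⟩ => by
    obtain rfl : u = u' := congrArg Prod.fst (hT.eq_of_snd hu hu' rfl)
    exact (PathFrom.unique hT h h').imp_right (congrArg (· + 1))

theorem PathFrom.target_unique (hT : IsRookConfig T) {r : Fin n} :
    ∀ {d : ℕ} {v v' : Fin n}, PathFrom T r d v → PathFrom T r d v' → v = v'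
  | 0, _, _, h, h' => h.1.trans h'.1.symm
  | d + 1, v, v', ⟨u, h, hu⟩, ⟨u', h', hu'⟩ => by
    obtain rfl := PathFrom.target_unique hT h h'
    exact congrArg Prod.snd (hT.eq_of_fst hu hu' rfl)

/-- In a cycle-free rook configuration, following the edges backwards from a vertex ends at a
vertex without incoming edge. -/
theorem exists_pathFrom (hT : IsRookConfig T) (hc : ∀ D, D ⊆ T → ¬ IsCycle D) (v : Fin n) :
    ∃ r d, PathFrom T r d v := by
  by_contra hv
  -- the vertices from which the backward walk does not end are permuted by the edges
  let B := {v : Fin n // ¬ ∃ r d, PathFrom T r d v}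
  have hpred : ∀ v : B, ∃ u : B, (u.1, v.1) ∈ T := by
    rintro ⟨v, hv⟩
    have hin : ∃ u, (u, v) ∈ T := by
      by_contra! h
      exact hv ⟨v, 0, rfl, h⟩
    obtain ⟨u, hu⟩ := hin
    exact ⟨⟨u, fun ⟨r, d, h⟩ => hv ⟨r, d + 1, u, h, hu⟩⟩, hu⟩
  choose f hf using hpred
  have hfi : Function.Injective f := fun a b hab => by
    have h1 := hf a
    rw [hab] at h1
    exact Subtype.ext (congrArg Prod.snd (hT.eq_of_fst h1 (hf b) rfl))
  let F : B ≃ B := Equiv.ofBijective f (Finite.injective_iff_bijective.1 hfi)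
  have hg : ∀ b : B, (b.1, (F.symm b).1) ∈ T := fun b => by
    have := hf (F.symm b)
    rwa [show f (F.symm b) = b from F.apply_symm_apply b] at this
  let b0 : B := ⟨v, hv⟩
  have hpos : 0 < Function.minimalPeriod F.symm b0 :=
    Function.minimalPeriod_pos_of_mem_periodicPts (F.symm.injective.mem_periodicPts b0)
  obtain ⟨k, hk⟩ := Nat.exists_eq_add_of_le' hpos
  let x : Fin (k + 1) → Fin n := fun i => (F.symm^[i.val] b0).1
  have hstep : ∀ i : Fin (k + 1), x (i + 1) = (F.symm (F.symm^[i.val] b0)).1 := fun i => by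
    have h1 : (i + 1 : Fin (k + 1)).val = (i.val + 1) % Function.minimalPeriod F.symm b0 := by
      rw [hk, Fin.val_add, Fin.val_one', Nat.add_mod_mod]
    change (F.symm^[(i + 1 : Fin (k + 1)).val] b0).1 = _
    rw [h1, Function.iterate_mod_minimalPeriod_eq, Function.iterate_succ_apply']
  refine hc (Finset.univ.image fun i => (x i, x (i + 1))) ?_ ⟨k, x, fun i j hij => ?_, rfl⟩
  · intro e he
    obtain ⟨i, -, rfl⟩ := Finset.mem_image.1 he
    rw [hstep]
    exact hg _
  · refine Fin.ext (Function.iterate_injOn_Iio_minimalPeriod (f := F.symm) (x := b0) ?_ ?_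
      (Subtype.ext hij))
    · rw [hk]; exact i.2
    · rw [hk]; exact j.2

/-- A cycle-free rook configuration is a disjoint union of directed paths; concatenating the paths
gives a linear order whose configuration contains it. -/
theorem exists_subset_linearOrderConfig (hT : IsRookConfig T)
    (hc : ∀ D, D ⊆ T → ¬ IsCycle D) : ∃ ρ : Fin n ≃ Fin n, T ⊆ linearOrderConfig ρ := by
  choose r d hrd using exists_pathFrom hT hc
  -- vertices are ordered first by the start of their path, then by the position on the path
  let key : Fin n → Fin n ×ₗ ℕ := fun v => toLex (r v, d v)
  have hkey : Function.Injective key := fun v w h => by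
    obtain ⟨h1, h2⟩ := Prod.mk.inj (toLex.injective h)
    have hv := hrd v
    rw [h1, h2] at hv
    exact hv.target_unique hT (hrd w)
  let s : Finset (Fin n ×ₗ ℕ) := Finset.univ.image key
  have hs : s.card = n := by simp [s, Finset.card_image_of_injective _ hkey]
  let K : Fin n ≃ s := Equiv.ofBijective
    (fun v => ⟨key v, Finset.mem_image_of_mem _ (Finset.mem_univ v)⟩)
    ⟨fun v w h => hkey (congrArg Subtype.val h), fun ⟨y, hy⟩ => by
      obtain ⟨v, -, rfl⟩ := Finset.mem_image.1 hy
      exact ⟨v, rfl⟩⟩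
  refine ⟨(s.orderIsoOfFin hs).toEquiv.trans K.symm, fun e he => ?_⟩
  rw [linearOrderConfig, Finset.mem_filter]
  refine ⟨Finset.mem_univ _, ?_⟩
  obtain ⟨h1, h2⟩ := (hrd e.2).unique hT (d' := d e.1 + 1) ⟨e.1, hrd e.1, he⟩
  have hcov : K e.1 ⋖ K e.2 := by
    constructor
    · change key e.1 < key e.2
      simp [key, Prod.Lex.toLex_lt_toLex, h1, h2]
    · rintro ⟨y, hy⟩ hlt1 hlt2
      obtain ⟨v, -, rfl⟩ := Finset.mem_image.1 hy
      change key e.1 < key v at hlt1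
      change key v < key e.2 at hlt2
      simp only [key, Prod.Lex.toLex_lt_toLex, h1, h2] at hlt1 hlt2
      rcases hlt1 with h | h <;> rcases hlt2 with h' | h'
      · exact absurd (h.trans h') (lt_irrefl _)
      · exact h.ne' h'.1
      · exact h'.ne h.1.symm
      · omega
  have := (apply_covBy_apply_iff (s.orderIsoOfFin hs).symm).2 hcov
  rw [Fin.covBy_iff, Nat.covBy_iff_add_one_eq] at this
  exact this

/-- The faces of the cycle-free chessboard complex are the nonempty rook configurations without
cycles. -/
theorem mem_cycleFreeComplex : T ∈ (cycleFreeComplex n).faces ↔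
    T.Nonempty ∧ IsRookConfig T ∧ ∀ D, D ⊆ T → ¬ IsCycle D := by
  refine and_congr_right fun _ => ⟨?_, fun h => exists_subset_linearOrderConfig h.1 h.2⟩
  rintro ⟨ρ, hρ⟩
  have hstep : ∀ e ∈ T, (ρ.symm e.1 : ℕ) + 1 = ρ.symm e.2 := fun e he =>
    (Finset.mem_filter.1 (hρ he)).2
  refine ⟨fun e he f hf hef => ⟨fun h => hef (Prod.ext h ?_), fun h => hef (Prod.ext ?_ h)⟩, ?_⟩
  · have h1 := hstep e he
    rw [h, hstep f hf] at h1
    exact ρ.symm.injective (Fin.ext h1.symm)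
  · have h1 := hstep e he
    rw [h, ← hstep f hf] at h1
    exact ρ.symm.injective (Fin.ext (by omega))
  · rintro D hD hcyc
    obtain ⟨e, he, hmax⟩ := Finset.exists_max_image D (fun e => (ρ.symm e.1 : ℕ)) hcyc.nonempty
    obtain ⟨f, hf, hfe⟩ := hcyc.exists_mem_fst he
    have h1 := hmax f hf
    have h2 := hstep e (hD he)
    rw [hfe] at h1
    omega

end DiGraph

namespace DiGraph

variable {n m p : ℕ} {S T C D : DiGraph n}

/-! ### The star of a multicycle -/

theorem IsCycle.image {ι : Fin m → Fin n} (hι : Function.Injective ι) {D : DiGraph m}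
    (hD : IsCycle D) : IsCycle (D.image (Prod.map ι ι)) := by
  obtain ⟨k, x, hx, rfl⟩ := hD
  exact ⟨k, ι ∘ x, hι.comp hx, by rw [Finset.image_image]; rfl⟩

/-- A configuration contains a cycle if its image under an injective map of vertices does. -/
theorem IsCycle.exists_of_image {ι : Fin m → Fin n} (hι : Function.Injective ι) {T : DiGraph m}
    {D : DiGraph n} (hD : IsCycle D) (h : D ⊆ T.image (Prod.map ι ι)) :
    ∃ D', D' ⊆ T ∧ IsCycle D' := by
  obtain ⟨k, x, hx, rfl⟩ := hD
  have hmem : ∀ i, ∃ e ∈ T, Prod.map ι ι e = (x i, x (i + 1)) := fun i =>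
    Finset.mem_image.1 (h (Finset.mem_image_of_mem _ (Finset.mem_univ i)))
  choose e he hex using hmem
  have h1 : ∀ i, ι (e i).1 = x i := fun i => congrArg Prod.fst (hex i)
  have h2 : ∀ i, ι (e i).2 = x (i + 1) := fun i => congrArg Prod.snd (hex i)
  refine ⟨Finset.univ.image fun i => ((e i).1, (e (i + 1)).1), ?_,
    k, fun i => (e i).1, fun i j hij => hx ?_, rfl⟩
  · intro f hf
    obtain ⟨i, -, rfl⟩ := Finset.mem_image.1 hf
    rw [show (e (i + 1)).1 = (e i).2 from hι ((h1 _).trans (h2 i).symm)]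
    exact he i
  · rw [← h1, ← h1]
    exact congrArg ι hij

theorem isCycle_loop (v : Fin n) : IsCycle {(v, v)} :=
  ⟨0, fun _ => v, fun _ _ _ => Subsingleton.elim (α := Fin 1) _ _, by
    ext e; simp⟩

theorem ne_of_cycleFree (hc : ∀ D, D ⊆ T → ¬ IsCycle D) {e : Fin n × Fin n} (he : e ∈ T) :
    e.1 ≠ e.2 := by
  obtain ⟨v, w⟩ := e
  rintro (rfl : v = w)
  exact hc _ (Finset.singleton_subset_iff.2 he) (isCycle_loop v)

namespace IsMulticycle

theorem card_compl_tails (hC : IsMulticycle p C) : C.tailsᶜ.card = n - C.length := by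
  rw [Finset.card_compl, hC.card_tails, Fintype.card_fin]

/-- The enumeration of the vertices that do not lie on the multicycle `C`. -/
def complVertex (hC : IsMulticycle p C) : Fin (n - C.length) → Fin n :=
  C.tailsᶜ.orderEmbOfFin hC.card_compl_tails

theorem injective_complVertex (hC : IsMulticycle p C) : Function.Injective hC.complVertex :=
  (C.tailsᶜ.orderEmbOfFin hC.card_compl_tails).injective

theorem complVertex_notMem (hC : IsMulticycle p C) (a : Fin (n - C.length)) :
    hC.complVertex a ∉ C.tails :=
  Finset.mem_compl.1 (Finset.orderEmbOfFin_mem _ hC.card_compl_tails a)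

theorem exists_complVertex (hC : IsMulticycle p C) {v : Fin n} (hv : v ∉ C.tails) :
    ∃ a, hC.complVertex a = v := by
  have : v ∈ Set.range (C.tailsᶜ.orderEmbOfFin hC.card_compl_tails) := by
    rw [Finset.range_orderEmbOfFin]
    simpa using hv
  exact this

/-- The edges of `C`, followed by the edges between the vertices that do not lie on `C`. -/
def starMap (hC : IsMulticycle p C) :
    Fin C.length ⊕ (Fin (n - C.length) × Fin (n - C.length)) → Fin n × Fin n :=
  Sum.elim (fun i => ((C.equivFinOfCardEq (card_eq_length C)).symm i).1)
    (Prod.map hC.complVertex hC.complVertex)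

theorem starMap_inl_mem (hC : IsMulticycle p C) (i : Fin C.length) :
    hC.starMap (Sum.inl i) ∈ C := Subtype.property _

theorem exists_starMap_inl (hC : IsMulticycle p C) {e : Fin n × Fin n} :
    (∃ i, hC.starMap (Sum.inl i) = e) ↔ e ∈ C :=
  ⟨fun ⟨i, hi⟩ => hi ▸ hC.starMap_inl_mem i, fun he =>
    ⟨C.equivFinOfCardEq (card_eq_length C) ⟨e, he⟩, by simp [starMap]⟩⟩

theorem forall_starMap_inl (hC : IsMulticycle p C) :
    (∀ i, hC.starMap (Sum.inl i) ∈ S) ↔ C ⊆ S := by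
  constructor
  · intro h e he
    obtain ⟨i, rfl⟩ := hC.exists_starMap_inl.2 he
    exact h i
  · exact fun h i => h (hC.starMap_inl_mem i)

theorem starMap_inr_notMem (hC : IsMulticycle p C)
    (e : Fin (n - C.length) × Fin (n - C.length)) : hC.starMap (Sum.inr e) ∉ C :=
  fun h => hC.complVertex_notMem e.1 (fst_mem_tails h)

theorem injective_starMap (hC : IsMulticycle p C) : Function.Injective hC.starMap := by
  refine Function.Injective.sumElim ?_ ?_ fun i e h => ?_
  · exact Subtype.val_injective.comp (Equiv.injective _)
  · exact hC.injective_complVertex.prodMap hC.injective_complVertex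
  · have hi := hC.starMap_inl_mem i
    rw [show hC.starMap (Sum.inl i) = hC.starMap (Sum.inr e) from h] at hi
    exact hC.starMap_inr_notMem e hi

/-- Let `K` consist of the nonempty rook configurations whose edges satisfy `P`, where `P` allows
all edges that are not loops. Then the star of a `p`-multicycle `C` in `F_p(K)` is the join of the
simplex `C` and the cycle-free chessboard complex on the vertices that do not lie on `C`. -/
theorem isStar {K : PreAbstractSimplicialComplex (Fin n × Fin n)} (hK : K ≤ chessboardComplex n)
    {P : Fin n × Fin n → Prop} (hP : ∀ e, e.1 ≠ e.2 → P e)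
    (hKP : ∀ S, S ∈ K.faces ↔ S.Nonempty ∧ IsRookConfig S ∧ ∀ e ∈ S, P e) (hp : 1 ≤ p)
    (hC : IsMulticycle p C) (hCP : ∀ e ∈ C, P e) :
    IsStar (cycleFiltration K hK p) (cycleFreeComplex (n - C.length)) hC.starMap where
  injective := hC.injective_starMap
  mem_faces_iff S := by
    rw [hC.forall_starMap_inl]
    have hι := hC.injective_complVertex
    constructor
    · rintro ⟨⟨hSK, hSp⟩, hCS⟩
      obtain ⟨-, hS, hSP⟩ := (hKP S).1 hSK
      let T : DiGraph (n - C.length) :=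
        Finset.univ.filter fun e => hC.starMap (Sum.inr e) ∈ S
      have hTS : ∀ e, e ∈ T ↔ hC.starMap (Sum.inr e) ∈ S := fun e => by simp [T]
      refine ⟨T, ?_, fun v => ?_⟩
      · rcases T.eq_empty_or_nonempty with hT | hT
        · exact Or.inl hT
        refine Or.inr (mem_cycleFreeComplex.2 ⟨hT, fun e he f hf hef => ?_, fun D hD hcyc => ?_⟩)
        · obtain ⟨h1, h2⟩ := hS _ ((hTS e).1 he) _ ((hTS f).1 hf)
            fun h => hef (Sum.inr_injective (hC.injective_starMap h))
          exact ⟨fun h => h1 (congrArg hC.complVertex h), fun h => h2 (congrArg hC.complVertex h)⟩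
        · have hcyc' := hcyc.image hι
          have hmem : D.image (Prod.map hC.complVertex hC.complVertex) ∈ cycles S := by
            refine (mem_cycles hS).2 ⟨fun e he => ?_, hcyc'⟩
            obtain ⟨f, hf, rfl⟩ := Finset.mem_image.1 he
            exact (hTS f).1 (hD hf)
          rw [hC.cycles_eq_of_subset hS hCS hSp] at hmem
          obtain ⟨e, he⟩ := hcyc.nonempty
          exact hC.starMap_inr_notMem e
            (subset_of_mem_components hmem (Finset.mem_image_of_mem _ he))
      · rw [hC.exists_starMap_inl]
        constructor
        · intro hv
          by_cases hvC : v ∈ C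
          · exact Or.inl hvC
          have hout := mt (hC.mem_of_mem_tails hS hCS hv) hvC
          push Not at hout
          obtain ⟨a, ha⟩ := hC.exists_complVertex hout.1
          obtain ⟨b, hb⟩ := hC.exists_complVertex hout.2
          have hab : hC.starMap (Sum.inr (a, b)) = v := Prod.ext ha hb
          exact Or.inr ⟨(a, b), (hTS _).2 (hab ▸ hv), hab⟩
        · rintro (hv | ⟨e, he, rfl⟩)
          · exact hCS hv
          · exact (hTS e).1 he
    · rintro ⟨T, hT, hS⟩
      simp only [hC.exists_starMap_inl] at hS
      have hTr : IsRookConfig T := by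
        rcases hT with rfl | hT
        · intro e he
          simp at he
        · exact (mem_cycleFreeComplex.1 hT).2.1
      have hTc : ∀ D, D ⊆ T → ¬ IsCycle D := by
        rcases hT with rfl | hT
        · intro D hD hcyc
          rw [Finset.subset_empty.1 hD] at hcyc
          simpa using hcyc.nonempty
        · exact (mem_cycleFreeComplex.1 hT).2.2
      have hCS : C ⊆ S := fun e he => (hS e).2 (Or.inl he)
      have hrook : IsRookConfig S := by
        intro e heS f hfS hef
        rcases (hS e).1 heS with he | ⟨e, he, rfl⟩ <;> rcases (hS f).1 hfS with hf | ⟨f, hf, rfl⟩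
        · exact hC.isRookConfig e he f hf hef
        · exact ⟨fun h => hC.complVertex_notMem f.1 (h ▸ fst_mem_tails he :),
            fun h => hC.complVertex_notMem f.2 (h ▸ hC.snd_mem_tails he :)⟩
        · exact ⟨fun h => hC.complVertex_notMem e.1 (h ▸ fst_mem_tails hf :),
            fun h => hC.complVertex_notMem e.2 (h ▸ hC.snd_mem_tails hf :)⟩
        · obtain ⟨h1, h2⟩ := hTr e he f hf fun h => hef (by rw [h])
          exact ⟨fun h => h1 (hι h), fun h => h2 (hι h)⟩
      have hSP : ∀ e ∈ S, P e := by
        intro e heS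
        rcases (hS e).1 heS with he | ⟨e, he, rfl⟩
        · exact hCP e he
        · exact hP _ fun h => ne_of_cycleFree hTc he (hι h)
      refine ⟨⟨(hKP S).2 ⟨(hC.nonempty hp).mono hCS, hrook, hSP⟩, ?_⟩, hCS⟩
      rw [DiGraph.numCycles_eq, ← hC.1]
      refine Finset.card_le_card fun D hD => ?_
      obtain ⟨hDS, hcyc⟩ := (mem_cycles hrook).1 hD
      by_cases hDC : ∃ e ∈ D, e ∈ C
      · obtain ⟨e, heD, heC⟩ := hDC
        have h1 := (hC.isCycle_component heC).component_eq hrook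
          ((component_subset _).trans hCS) (self_mem_component heC)
        rw [← hcyc.component_eq hrook hDS heD, h1]
        exact component_mem_components heC
      · push Not at hDC
        have hDT : D ⊆ T.image (Prod.map hC.complVertex hC.complVertex) := fun e he => by
          obtain ⟨f, hf, hfe⟩ := ((hS e).1 (hDS he)).resolve_left (hDC e he)
          exact Finset.mem_image.2 ⟨f, hf, hfe⟩
        obtain ⟨D', hD', hcyc'⟩ := hcyc.exists_of_image hι hDT
        exact (hTc D' hD' hcyc').elim

end IsMulticycle

/-! ### The two filtrations -/

theorem cycleFiltration_zero {K : PreAbstractSimplicialComplex (Fin n × Fin n)}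
    (hK : K ≤ chessboardComplex n) {P : Fin n × Fin n → Prop} (hP : ∀ e, e.1 ≠ e.2 → P e)
    (hKP : ∀ S, S ∈ K.faces ↔ S.Nonempty ∧ IsRookConfig S ∧ ∀ e ∈ S, P e) :
    cycleFiltration K hK 0 = cycleFreeComplex n := by
  ext S
  rw [mem_cycleFreeComplex]
  change S ∈ K.faces ∧ numCycles S ≤ 0 ↔ _
  rw [hKP, Nat.le_zero]
  constructor
  · rintro ⟨⟨h1, h2, -⟩, h3⟩
    exact ⟨h1, h2, (numCycles_eq_zero h2).1 h3⟩
  · rintro ⟨h1, h2, h3⟩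
    exact ⟨⟨h1, h2, fun e he => hP e (ne_of_cycleFree h3 he)⟩, (numCycles_eq_zero h2).2 h3⟩

/-- The successive quotients of the filtration by the number of cycles, for a complex `K` of rook
configurations that is defined by a condition `P` on single edges. -/
theorem nonempty_quotient_cycleFiltration_homotopyEquiv
    {K : PreAbstractSimplicialComplex (Fin n × Fin n)}
    (hK : K ≤ chessboardComplex n) {P : Fin n × Fin n → Prop} (hP : ∀ e, e.1 ≠ e.2 → P e)
    (hKP : ∀ S, S ∈ K.faces ↔ S.Nonempty ∧ IsRookConfig S ∧ ∀ e ∈ S, P e) (hp : 1 ≤ p)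
    {𝒞 : Set (DiGraph n)} (h𝒞 : ∀ C, C ∈ 𝒞 ↔ IsMulticycle p C ∧ ∀ e ∈ C, P e)
    (hl : ∀ C ∈ 𝒞, 0 < C.length) :
    Nonempty (QuotientSpace (cycleFiltration K hK p) (cycleFiltration K hK (p - 1)) ≃ₕ
      JoinWedge 𝒞 hl) := by
  have hmul : ∀ C : 𝒞, IsMulticycle p C.1 := fun C => ((h𝒞 _).1 C.2).1
  refine nonempty_quotientSpace_homotopyEquiv (κ := fun C : 𝒞 => (hmul C).starMap)
    (fun C => (hmul C).isStar hK hP hKP hp ((h𝒞 _).1 C.2).2) ?_ ?_ fun C => hl C.1 C.2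
  · rintro (S : DiGraph n) ⟨hSK, hSp⟩
    obtain ⟨hne, hS, hSP⟩ := (hKP S).1 hSK
    simp only [IsMulticycle.forall_starMap_inl]
    constructor
    · rintro ⟨-, hSp'⟩ C hCS
      have := (hmul C).le_numCycles hS hCS
      omega
    · refine fun h => ⟨hSK, ?_⟩
      by_contra hlt
      have hcore := isMulticycle_core hS
      rw [show numCycles S = p by omega] at hcore
      exact h ⟨S.core, (h𝒞 _).2 ⟨hcore, fun e he => hSP e (core_subset S he)⟩⟩ (core_subset S)
  · rintro S ⟨hSK, hSp⟩ C C' hC hC'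
    have hS := ((hKP S).1 hSK).2.1
    rw [IsMulticycle.forall_starMap_inl] at hC hC'
    exact Subtype.ext (((hmul C).eq_core hS hC hSp).trans ((hmul C').eq_core hS hC' hSp).symm)

theorem nonempty_joinWedge_homeomorph_suspWedge (𝒞 : Set (DiGraph n))
    (hl : ∀ C ∈ 𝒞, 0 < C.length) : Nonempty (JoinWedge 𝒞 hl ≃ₜ SuspWedge 𝒞 hl) :=
  ⟨wedgeCongr (fun _ => joinHomeoIterSusp _ _) fun C => joinHomeoIterSusp_inl _ (hl C.1 C.2) _⟩

theorem mem_chessboardComplex_iff (S : DiGraph n) : S ∈ (chessboardComplex n).faces ↔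
    S.Nonempty ∧ IsRookConfig S ∧ ∀ e ∈ S, True := by
  simp only [implies_true, and_true]
  rfl

theorem mem_directedMatchingComplex_iff (S : DiGraph n) :
    S ∈ (directedMatchingComplex n).faces ↔
      S.Nonempty ∧ IsRookConfig S ∧ ∀ e ∈ S, e.1 ≠ e.2 := by
  constructor
  · exact fun h => ⟨h.1, (directedMatchingComplex_le n h).2, h.2.1⟩
  · rintro ⟨h1, h2, h3⟩
    refine ⟨h1, h3, fun v => ⟨Finset.card_le_one.2 fun e he f hf => ?_,
      Finset.card_le_one.2 fun e he f hf => ?_⟩⟩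
    · rw [Finset.mem_filter] at he hf
      exact h2.eq_of_fst he.1 hf.1 (he.2.trans hf.2.symm)
    · rw [Finset.mem_filter] at he hf
      exact h2.eq_of_snd he.1 hf.1 (he.2.trans hf.2.symm)

end DiGraph

end

theorem mainTheorem8 (n : ℕ) :
    (filtrationI n 0 = cycleFreeComplex n ∧ filtrationII n 0 = cycleFreeComplex n) ∧
    ∀ (p : ℕ) (hp : 1 ≤ p),
      (Nonempty (QuotientSpace (filtrationI n p) (filtrationI n (p - 1)) ≃ₕ
          JoinWedge (multicycles n p) (fun _ hC => DiGraph.length_pos hC hp)) ∧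
        Nonempty (JoinWedge (multicycles n p) (fun _ hC => DiGraph.length_pos hC hp) ≃ₜ
          SuspWedge (multicycles n p) (fun _ hC => DiGraph.length_pos hC hp))) ∧
      (Nonempty (QuotientSpace (filtrationII n p) (filtrationII n (p - 1)) ≃ₕ
          JoinWedge (multicyclesGeTwo n p) (fun _ hC => DiGraph.length_pos hC.1 hp)) ∧
        Nonempty (JoinWedge (multicyclesGeTwo n p) (fun _ hC => DiGraph.length_pos hC.1 hp) ≃ₜ
          SuspWedge (multicyclesGeTwo n p) (fun _ hC => DiGraph.length_pos hC.1 hp))) := by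
  have hP : ∀ e : Fin n × Fin n, e.1 ≠ e.2 → True := fun _ _ => trivial
  refine ⟨⟨DiGraph.cycleFiltration_zero le_rfl hP DiGraph.mem_chessboardComplex_iff,
    DiGraph.cycleFiltration_zero (directedMatchingComplex_le n) (fun _ h => h)
      DiGraph.mem_directedMatchingComplex_iff⟩, fun p hp => ⟨⟨?_, ?_⟩, ?_, ?_⟩⟩
  · exact DiGraph.nonempty_quotient_cycleFiltration_homotopyEquiv le_rfl hP
      DiGraph.mem_chessboardComplex_iff hp (fun C => by simp [multicycles]) _
  · exact DiGraph.nonempty_joinWedge_homeomorph_suspWedge _ _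
  · exact DiGraph.nonempty_quotient_cycleFiltration_homotopyEquiv (directedMatchingComplex_le n)
      (fun _ h => h) DiGraph.mem_directedMatchingComplex_iff hp
      (fun C => and_congr_right fun hC => hC.two_le_cycleType_iff) _
  · exact DiGraph.nonempty_joinWedge_homeomorph_suspWedge _ _
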